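/- **Model.** In each round $t\in\{1,\dots,T\}$ a seller with value $S^t\in[0,1]$ and a buyer with value $B^t\in[0,1]$ arrive. A fixed-price mechanism with two-bit feedback $\mathcal M$ posts real prices $(P^t,Q^t)$, chosen as a function of its internal randomness (independent of all values) and of the feedback $(\mathbf 1[S^r\le P^r],\mathbf 1[Q^r\le B^r])$, $r<t$, of the previous rounds. With $\mathrm{GFT}(s,b,p,q)=(b-s)\,\mathbf 1[s\le p]\,\mathbf 1[q\le b]$ and $\mathrm{Profit}(s,b,p,q)=(q-p)\,\mathbf 1[s\le p]\,\mathbf 1[q\le b]$, and for a joint law $\mu$ of $(S^t,B^t)_{t\le T}$, the regret of $\mathcal M$ on $\mu$ is $$\mathrm{Regret}^{\mathcal M}_\mu=\sup_{0\le p\le q\le 1}\mathbb E_\mu\Big[\sum_{t=1}^T\mathrm{GFT}(S^t,B^t,p,q)\Big]-\mathbb E_{\mu,\mathcal M}\Big[\sum_{t=1}^T\mathrm{GFT}(S^t,B^t,P^t,Q^t)\Big].$$ For a class $\mathcal C$ of joint laws, the worst-case regret of $\mathcal M$ is $\sup_{\mu\in\mathcal C}\mathrm{Regret}^{\mathcal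 M}_\mu$, and $\mathcal M$ is globally budget balanced (GBB) on $\mathcal C$ if for every $\mu\in\mathcal C$ one has $\sum_{t=1}^T\mathrm{Profit}(S^t,B^t,P^t,Q^t)\ge 0$ almost surely. **Theorem.** There are absolute constants $c>0$ and $T_0$ such that for every $T\ge T_0$ and each of the following classes $\mathcal C$, every $T$-round fixed-price mechanism with two-bit feedback that is GBB on $\mathcal C$ has worst-case regret at least $c\,T^{3/4}$ over $\mathcal C$: 1. correlated values: the pairs $(S^t,B^t)$ are i.i.d. from an arbitrary probability distribution $\mathcal D$ on $[0,1]^2$; 2. correlated values with bounded density: as in 1, where $\mathcal D$ has a density with respect to Lebesgue measure that is bounded by $M=224$; 3. adversarial values: $(S^t,B^t)_{t\le T}$ has an arbitrary joint distribution on $([0,1]^2)^T$. -/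

import Mathlib

open MeasureTheory
open scoped NNReal ENNReal

universe u

namespace BilateralTrade

noncomputable section

/-- Values are pairs `v = (s, b)` (seller, buyer) and prices are pairs `x = (p, q)`
(price posted to the seller, price posted to the buyer).
Two-bit feedback: does the seller accept, does the buyer accept. -/
def twoBit (v x : ℝ × ℝ) : Bool × Bool :=
  (decide (v.1 ≤ x.1), decide (x.2 ≤ v.2))

/-- The trade happens when both agents accept their prices. -/
def trade (v x : ℝ × ℝ) : ℝ :=
  if v.1 ≤ x.1 ∧ x.2 ≤ v.2 then 1 else 0

/-- Gains from trade `(b - s) * trade`. -/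
def gft (v x : ℝ × ℝ) : ℝ := (v.2 - v.1) * trade v x

/-- Profit `(q - p) * trade`. -/
def profit (v x : ℝ × ℝ) : ℝ := (x.2 - x.1) * trade v x

/-- A (randomized) `T`-round fixed-price mechanism with two-bit feedback. Its internal randomness
is a seed, drawn once from an arbitrary probability space, independently of the values.
In round `t` the pair of prices is a function of the seed and of the feedback received in the
rounds before `t`; the past prices are themselves functions of these data.
(There are finitely many feedback histories, hence measurability is asked for each of them.) -/
structure Mechanism (T : ℕ) where
  Seed : Type u
  [measurableSpaceSeed : MeasurableSpace Seed]
  seedLaw : Measure Seed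
  [isProbabilityMeasure_seedLaw : IsProbabilityMeasure seedLaw]
  price : (t : Fin T) → Seed → (Fin (t : ℕ) → Bool × Bool) → ℝ × ℝ
  measurable_price : ∀ (t : Fin T) (h : Fin (t : ℕ) → Bool × Bool),
    Measurable fun ω => price t ω h

attribute [instance] Mechanism.measurableSpaceSeed Mechanism.isProbabilityMeasure_seedLaw

variable {T : ℕ}

/-- The feedback received in the first `n` rounds, for the seed `ω` and the values `v`. -/
def Mechanism.history (A : Mechanism.{u} T) (ω : A.Seed) (v : Fin T → ℝ × ℝ) :
    (n : ℕ) → n ≤ T → (Fin n → Bool × Bool)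
  | 0, _ => Fin.elim0
  | n + 1, hn =>
      Fin.snoc (α := fun _ => Bool × Bool)
        (A.history ω v n (Nat.le_of_succ_le hn))
        (twoBit (v ⟨n, hn⟩) (A.price ⟨n, hn⟩ ω (A.history ω v n (Nat.le_of_succ_le hn))))

/-- The prices posted in round `t`, for the seed `ω` and the values `v`. -/
def Mechanism.postedPrice (A : Mechanism.{u} T) (ω : A.Seed) (v : Fin T → ℝ × ℝ) (t : Fin T) :
    ℝ × ℝ :=
  A.price t ω (A.history ω v t t.isLt.le)

/-- Expected total gains from trade of a mechanism when the values of the `T` rounds have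
joint law `μ` (and are independent of the seed). -/
def Mechanism.totalGFT (A : Mechanism.{u} T) (μ : Measure (Fin T → ℝ × ℝ)) : ℝ :=
  ∫ z, ∑ t, gft (z.2 t) (A.postedPrice z.1 z.2 t) ∂(A.seedLaw.prod μ)

/-- The benchmark: the largest expected total gains from trade of a single pair of prices
`0 ≤ p ≤ q ≤ 1` posted in all rounds. -/
def optimalGFT (μ : Measure (Fin T → ℝ × ℝ)) : ℝ :=
  sSup ((fun x : ℝ × ℝ => ∫ v, ∑ t, gft (v t) x ∂μ) '' {x | 0 ≤ x.1 ∧ x.1 ≤ x.2 ∧ x.2 ≤ 1})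

/-- Regret of a mechanism against the joint law `μ`. -/
def Mechanism.regret (A : Mechanism.{u} T) (μ : Measure (Fin T → ℝ × ℝ)) : ℝ :=
  optimalGFT μ - A.totalGFT μ

/-- Worst-case regret over a class of joint laws of the values. -/
def Mechanism.worstCaseRegret (A : Mechanism.{u} T) (𝒟 : Set (Measure (Fin T → ℝ × ℝ))) : ℝ :=
  sSup (A.regret '' 𝒟)

/-- Global budget balance over a class of joint laws of the values: the total profit is almost
surely nonnegative, whatever law of the class the values have. -/
def Mechanism.IsGBB (A : Mechanism.{u} T) (𝒟 : Set (Measure (Fin T → ℝ × ℝ))) : Prop :=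
  ∀ μ ∈ 𝒟, ∀ᵐ z ∂(A.seedLaw.prod μ), 0 ≤ ∑ t, profit (z.2 t) (A.postedPrice z.1 z.2 t)

/-- Probability distributions of one value pair, supported on the unit square. -/
def IsValueLaw (D : Measure (ℝ × ℝ)) : Prop :=
  IsProbabilityMeasure D ∧ ∀ᵐ x ∂D, x ∈ Set.Icc (0 : ℝ) 1 ×ˢ Set.Icc (0 : ℝ) 1

/-- Density boundedness: a density with respect to Lebesgue measure that is at most `M`. -/
def HasDensityBoundedBy (M : ℝ≥0) (D : Measure (ℝ × ℝ)) : Prop :=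
  ∃ f : ℝ × ℝ → ℝ≥0∞, Measurable f ∧ (∀ x, f x ≤ M) ∧ D = volume.withDensity f

/-- Adversarial values: an arbitrary joint law on `([0,1]²)^T`. -/
def adversarialValues (T : ℕ) : Set (Measure (Fin T → ℝ × ℝ)) :=
  {μ | IsProbabilityMeasure μ ∧
    ∀ᵐ v ∂μ, ∀ t, v t ∈ Set.Icc (0 : ℝ) 1 ×ˢ Set.Icc (0 : ℝ) 1}

/-- Correlated values: the `T` value pairs are i.i.d. from an arbitrary law on `[0,1]²`. -/
def correlatedValues (T : ℕ) : Set (Measure (Fin T → ℝ × ℝ)) :=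
  {μ | ∃ D : Measure (ℝ × ℝ), IsValueLaw D ∧ μ = Measure.pi fun _ => D}

/-- Correlated values under density boundedness with parameter `M`. -/
def densityBoundedCorrelatedValues (T : ℕ) (M : ℝ≥0) : Set (Measure (Fin T → ℝ × ℝ)) :=
  {μ | ∃ D : Measure (ℝ × ℝ),
    IsValueLaw D ∧ HasDensityBoundedBy M D ∧ μ = Measure.pi fun _ => D}

end

end BilateralTrade

/-! The lower bound is a needle-in-a-haystack argument in which looking for the needle is expensive.
The base law has three blocks: low sellers facing middle buyers (mass 1/8), middle sellers facing
high buyers (mass 1/8), and a central block of mass 3/4 that trades at every price `p = q` in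
`[7/16, 9/16]`. Signed corrections tilt the first two blocks so that, conditionally on the value of
the middle agent, the expected gain is always 5/16. Raising `p = q` then loses buyers and wins
sellers of exactly equal worth, and all these prices earn 23/128.

A perturbation pairs buyers in the upper half of a cell of width `w` with lower sellers, and buyers
in its lower half with higher ones. It changes neither marginal, but raises the value of the price
at the centre of the cell by order `w`. If `p ≥ 3/8`, every low seller accepts and the two bits have
the same law as before. Only rounds with `p < 3/8` and `q` inside the cell carry information; they
lose most of the central block, hence at least 1/16 (`tradeValue_le_of_le`), and move the outcome
probabilities only by a relative amount of order `w` (`abs_feedbackLaw_sub_le`).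

Global budget balance allows `p > q` in some rounds, financed by others. It is dualized: total
profit is nonnegative, so adding 5/14 times the profit to the gains can only help the mechanism
(`Mechanism.integrable_and_totalGFT_le`). For this multiplier no pair of prices exceeds 23/128 under
the base law (`tradeValue_zero_le`), and the cell is the only place where a perturbed law gives more
(`tradeValue_le`).

With `K` cells and `w` of order `1/K`, recognizing one cell takes order `K^2` costly rounds, so
searching all of them costs order `K^3`, while not finding the right one costs order `T/K`. These
balance at `K` of order `T^(1/4)`, which gives `T^(3/4)`. `sum_totalValue_le` makes this precise for
a fixed seed through relative entropy; integrating over the seed gives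
`Mechanism.le_worstCaseRegret`. All instances are i.i.d. with bounded density, so they lie in each
of the three classes. -/

namespace BilateralTrade

/-! ### Adaptive sampling with finitely many outcomes: relative entropy and the needle bound -/

section AdaptiveSampling

variable {O X : Type*}

/-- Probability of a sequence of outcomes when the action taken after the outcomes `h` is
`σ n h`, and an action `x` has outcome `o` with probability `k x o`. -/
noncomputable def histProb (k : X → O → ℝ) (σ : (n : ℕ) → (Fin n → O) → X) :
    (n : ℕ) → (Fin n → O) → ℝ
  | 0, _ => 1
  | n + 1, h => histProb k σ n (Fin.init h) * k (σ n (Fin.init h)) (h (Fin.last n))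

theorem histProb_nonneg {k : X → O → ℝ} (hk : ∀ x o, 0 ≤ k x o)
    (σ : (n : ℕ) → (Fin n → O) → X) (n : ℕ) (h : Fin n → O) : 0 ≤ histProb k σ n h := by
  induction n with
  | zero => simp [histProb]
  | succ n ih => exact mul_nonneg (ih _) (hk _ _)

theorem sum_pi_snoc [Fintype O] {M : Type*} [AddCommMonoid M] (n : ℕ)
    (F : (Fin (n + 1) → O) → M) :
    ∑ h, F h = ∑ h : Fin n → O, ∑ o : O, F (Fin.snoc (α := fun _ => O) h o) := by
  rw [← (Fin.snocEquiv (fun _ : Fin (n + 1) => O)).sum_comp F, Fintype.sum_prod_type,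
    Finset.sum_comm]
  rfl

theorem histProb_snoc (k : X → O → ℝ) (σ : (n : ℕ) → (Fin n → O) → X) (n : ℕ)
    (h : Fin n → O) (o : O) :
    histProb k σ (n + 1) (Fin.snoc (α := fun _ => O) h o) = histProb k σ n h * k (σ n h) o := by
  simp [histProb]

theorem sum_histProb [Fintype O] {k : X → O → ℝ} (hk : ∀ x, ∑ o, k x o = 1)
    (σ : (n : ℕ) → (Fin n → O) → X) (n : ℕ) : ∑ h, histProb k σ n h = 1 := by
  induction n with
  | zero => simp [histProb]
  | succ n ih =>
    rw [sum_pi_snoc]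
    simp_rw [histProb_snoc, ← Finset.mul_sum, hk, mul_one, ih]

/-- Relative entropy of two laws on a finite set, written with the junk value of `log 0`. -/
noncomputable def relEntropy {H : Type*} [Fintype H] (P Q : H → ℝ) : ℝ :=
  ∑ h, P h * Real.log (P h / Q h)

/-- Relative entropy is at most the chi-square divergence, by `log x ≤ x - 1`; the bound `δ ≤ 1/2`
keeps the denominators `q` above `p / 2`, whence the factor 2. -/
theorem relEntropy_le_of_abs_sub_le [Fintype O] {p q : O → ℝ} {δ : ℝ} (hp : ∀ o, 0 ≤ p o)
    (hp1 : ∑ o, p o = 1) (hq1 : ∑ o, q o = 1) (hδ : δ ≤ 1 / 2)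
    (h : ∀ o, |q o - p o| ≤ δ * p o) : relEntropy p q ≤ 2 * δ ^ 2 := by
  have key : ∀ o, p o * Real.log (p o / q o) ≤ (p o - q o) + 2 * δ ^ 2 * p o := by
    intro o
    have ho := h o
    rcases (hp o).eq_or_lt with h0 | h0
    · rw [← h0] at ho ⊢
      have : q o = 0 := by simpa using ho
      simp [this]
    · have hq : p o / 2 ≤ q o := by
        have := (abs_le.1 ho).1
        nlinarith
      have hqpos : 0 < q o := by linarith
      have hlog := Real.log_le_sub_one_of_pos (div_pos h0 hqpos)
      have hsq : (p o - q o) ^ 2 ≤ δ ^ 2 * p o ^ 2 := by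
        have := sq_le_sq' (by linarith [(abs_le.1 ho).1] : -(δ * p o) ≤ q o - p o)
          (abs_le.1 ho).2
        nlinarith
      calc p o * Real.log (p o / q o) ≤ p o * (p o / q o - 1) := by gcongr
        _ = (p o - q o) + (p o - q o) ^ 2 / q o := by field_simp; ring
        _ ≤ _ := by
          gcongr
          rw [div_le_iff₀ hqpos]
          nlinarith [mul_nonneg (sq_nonneg δ) h0.le]
  calc relEntropy p q ≤ ∑ o, ((p o - q o) + 2 * δ ^ 2 * p o) :=
        Finset.sum_le_sum fun o _ => key o
    _ = 2 * δ ^ 2 := by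
        rw [Finset.sum_add_distrib, Finset.sum_sub_distrib, hp1, hq1, ← Finset.mul_sum, hp1]
        ring

/-- A pointwise Pinsker inequality. With `a = √p` and `b = √q`, the entropy term is at least `(a -
b)^2`, while `|q - p| = |a - b| (a + b) ≤ 8 (a - b)^2 + (a + b)^2 / 32`. The last hypothesis rules
out the junk value at `q = 0`. -/
theorem abs_sub_le_mul_log {p q : ℝ} (hp : 0 ≤ p) (hq : 0 ≤ q) (hpq : 0 < p → 0 < q) :
    |q - p| ≤ 8 * (p * Real.log (p / q) + (q - p)) + (p + q) / 16 := by
  rcases hp.eq_or_lt with rfl | h0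
  · simp only [zero_mul, sub_zero, zero_add, abs_of_nonneg hq]
    linarith
  have hq0 := hpq h0
  set a := √p with ha
  set b := √q with hb
  have ha0 : 0 < a := Real.sqrt_pos.2 h0
  have hb0 : 0 < b := Real.sqrt_pos.2 hq0
  have hpa : p = a ^ 2 := (Real.sq_sqrt hp).symm
  have hqb : q = b ^ 2 := (Real.sq_sqrt hq).symm
  have hlog : Real.log (b / a) ≤ b / a - 1 := Real.log_le_sub_one_of_pos (div_pos hb0 ha0)
  have h1 : Real.log (p / q) = -(2 * Real.log (b / a)) := by
    rw [hpa, hqb, ← div_pow, Real.log_pow, ← inv_div b a, Real.log_inv]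
    push_cast
    ring
  have h2 : p * Real.log (p / q) ≥ 2 * a ^ 2 - 2 * a * b := by
    rw [h1, hpa]
    have : a ^ 2 * (b / a - 1) = a * b - a ^ 2 := by field_simp
    nlinarith [mul_le_mul_of_nonneg_left hlog (sq_nonneg a)]
  rw [abs_le]
  constructor <;> nlinarith [sq_nonneg (16 * (b - a) + (a + b)), sq_nonneg (16 * (b - a) - (a + b)),
    sq_nonneg (a - b)]

/-- Pinsker's inequality made linear in the entropy, at the price of a constant 1/8. Linearity
allows summation over the environments without Cauchy–Schwarz. -/
theorem sum_mul_le_add_relEntropy {H : Type*} [Fintype H] {P Q φ : H → ℝ} (hP : ∀ h, 0 ≤ P h)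
    (hQ : ∀ h, 0 ≤ Q h) (hPQ : ∀ h, 0 < P h → 0 < Q h) (hP1 : ∑ h, P h = 1)
    (hQ1 : ∑ h, Q h = 1) (hφ0 : ∀ h, 0 ≤ φ h) (hφ1 : ∀ h, φ h ≤ 1) :
    ∑ h, Q h * φ h ≤ ∑ h, P h * φ h + 1 / 8 + 8 * relEntropy P Q := by
  have key : ∀ h, Q h * φ h ≤ P h * φ h +
      (8 * (P h * Real.log (P h / Q h) + (Q h - P h)) + (P h + Q h) / 16) := by
    intro h
    have h1 := abs_sub_le_mul_log (hP h) (hQ h) (hPQ h)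
    have h2 : (Q h - P h) * φ h ≤ |Q h - P h| :=
      (mul_le_mul_of_nonneg_right (le_abs_self _) (hφ0 h)).trans
        (mul_le_of_le_one_right (abs_nonneg _) (hφ1 h))
    linarith
  refine (Finset.sum_le_sum fun h _ => key h).trans (le_of_eq ?_)
  simp only [Finset.sum_add_distrib, ← Finset.mul_sum, ← Finset.sum_div, Finset.sum_sub_distrib,
    hP1, hQ1, relEntropy]
  ring

section Comparison

variable {k₀ k₁ : X → O → ℝ} {δ : X → ℝ}

/-- Absolute continuity along histories, so that the logarithms in the relative entropy are never
junk on the support of the base run. -/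
theorem histProb_pos_of_pos (hk₀ : ∀ x o, 0 ≤ k₀ x o) (hδ : ∀ x, δ x ≤ 1 / 2)
    (h : ∀ x o, |k₁ x o - k₀ x o| ≤ δ x * k₀ x o) (σ : (n : ℕ) → (Fin n → O) → X) (n : ℕ)
    (y : Fin n → O) : 0 < histProb k₀ σ n y → 0 < histProb k₁ σ n y := by
  induction n with
  | zero => simp [histProb]
  | succ n ih =>
    intro hy
    have h1 : 0 < histProb k₀ σ n (Fin.init y) :=
      lt_of_le_of_ne (histProb_nonneg hk₀ σ n _) fun h0 => by simp [histProb, ← h0] at hy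
    have h2 : 0 < k₀ (σ n (Fin.init y)) (y (Fin.last n)) :=
      lt_of_le_of_ne (hk₀ _ _) fun h0 => by simp [histProb, ← h0] at hy
    refine mul_pos (ih _ h1) ?_
    have h3 := (abs_le.1 (h (σ n (Fin.init y)) (y (Fin.last n)))).1
    nlinarith [hδ (σ n (Fin.init y))]

/-- The chain rule: each round adds the expected entropy between the outcome laws of the action just
taken, at most `2 δ^2`. -/
theorem relEntropy_histProb_le [Fintype O] (hk₀ : ∀ x o, 0 ≤ k₀ x o) (hk₀1 : ∀ x, ∑ o, k₀ x o = 1)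
    (hk₁1 : ∀ x, ∑ o, k₁ x o = 1) (hδ : ∀ x, δ x ≤ 1 / 2)
    (h : ∀ x o, |k₁ x o - k₀ x o| ≤ δ x * k₀ x o) (σ : (n : ℕ) → (Fin n → O) → X) (n : ℕ) :
    relEntropy (histProb k₀ σ n) (histProb k₁ σ n) ≤
      ∑ t ∈ Finset.range n, ∑ y, histProb k₀ σ t y * (2 * δ (σ t y) ^ 2) := by
  induction n with
  | zero => simp [relEntropy, histProb]
  | succ n ih =>
    rw [Finset.sum_range_succ]
    refine le_trans ?_ (add_le_add_left ih _)
    have hstep : ∀ y : Fin n → O, ∑ o, histProb k₀ σ (n + 1) (Fin.snoc (α := fun _ => O) y o) *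
        Real.log (histProb k₀ σ (n + 1) (Fin.snoc (α := fun _ => O) y o) /
          histProb k₁ σ (n + 1) (Fin.snoc (α := fun _ => O) y o)) ≤
        histProb k₀ σ n y * Real.log (histProb k₀ σ n y / histProb k₁ σ n y) +
          histProb k₀ σ n y * (2 * δ (σ n y) ^ 2) := by
      intro y
      simp_rw [histProb_snoc]
      rcases (histProb_nonneg hk₀ σ n y).eq_or_lt with h0 | h0
      · simp [← h0]
      have h1 := histProb_pos_of_pos hk₀ hδ h σ n y h0
      have hterm : ∀ o, histProb k₀ σ n y * k₀ (σ n y) o *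
          Real.log (histProb k₀ σ n y * k₀ (σ n y) o / (histProb k₁ σ n y * k₁ (σ n y) o)) =
          histProb k₀ σ n y * Real.log (histProb k₀ σ n y / histProb k₁ σ n y) * k₀ (σ n y) o +
          histProb k₀ σ n y * (k₀ (σ n y) o * Real.log (k₀ (σ n y) o / k₁ (σ n y) o)) := by
        intro o
        rcases (hk₀ (σ n y) o).eq_or_lt with h2 | h2
        · simp [← h2]
        have h3 : 0 < k₁ (σ n y) o := by
          have h3 := (abs_le.1 (h (σ n y) o)).1
          nlinarith [hδ (σ n y)]
        rw [mul_div_mul_comm, Real.log_mul (div_pos h0 h1).ne' (div_pos h2 h3).ne']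
        ring
      simp_rw [hterm]
      rw [Finset.sum_add_distrib, ← Finset.mul_sum, ← Finset.mul_sum, hk₀1, mul_one]
      gcongr
      exact relEntropy_le_of_abs_sub_le (hk₀ _) (hk₀1 _) (hk₁1 _) (hδ _) (h _)
    rw [relEntropy, sum_pi_snoc]
    refine (Finset.sum_le_sum fun y _ => hstep y).trans (le_of_eq ?_)
    rw [Finset.sum_add_distrib, relEntropy]

end Comparison

/-- Expected total reward over `T` steps when the action `x` has expected reward `L x`. -/
noncomputable def totalValue [Fintype O] (k : X → O → ℝ) (L : X → ℝ)
    (σ : (n : ℕ) → (Fin n → O) → X) (T : ℕ) : ℝ :=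
  ∑ t ∈ Finset.range T, ∑ h, histProb k σ t h * L (σ t h)

section TotalValue

variable [Fintype O]

theorem totalValue_mono {k : X → O → ℝ} (hk : ∀ x o, 0 ≤ k x o) {L L' : X → ℝ}
    (hL : ∀ x, L x ≤ L' x) (σ : (n : ℕ) → (Fin n → O) → X) (T : ℕ) :
    totalValue k L σ T ≤ totalValue k L' σ T :=
  Finset.sum_le_sum fun _ _ => Finset.sum_le_sum fun _ _ =>
    mul_le_mul_of_nonneg_left (hL _) (histProb_nonneg hk _ _ _)

theorem totalValue_const {k : X → O → ℝ} (hk1 : ∀ x, ∑ o, k x o = 1)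
    (σ : (n : ℕ) → (Fin n → O) → X) (T : ℕ) (G : ℝ) :
    totalValue k (fun _ => G) σ T = T * G := by
  simp [totalValue, ← Finset.sum_mul, sum_histProb hk1]

theorem totalValue_add (k : X → O → ℝ) (L L' : X → ℝ) (σ : (n : ℕ) → (Fin n → O) → X) (T : ℕ) :
    totalValue k (fun x => L x + L' x) σ T = totalValue k L σ T + totalValue k L' σ T := by
  simp [totalValue, mul_add, Finset.sum_add_distrib]

theorem totalValue_const_mul (k : X → O → ℝ) (L : X → ℝ) (σ : (n : ℕ) → (Fin n → O) → X)
    (T : ℕ) (c : ℝ) : totalValue k (fun x => c * L x) σ T = c * totalValue k L σ T := by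
  simp [totalValue, Finset.mul_sum, mul_left_comm]

theorem totalValue_sum {ι : Type*} (s : Finset ι) (k : X → O → ℝ) (L : ι → X → ℝ)
    (σ : (n : ℕ) → (Fin n → O) → X) (T : ℕ) :
    totalValue k (fun x => ∑ i ∈ s, L i x) σ T = ∑ i ∈ s, totalValue k (L i) σ T := by
  simp only [totalValue, Finset.mul_sum]
  conv_rhs => rw [Finset.sum_comm]
  exact Finset.sum_congr rfl fun t _ => Finset.sum_comm

/-- Each of the `T` rounds pays 8 times the entropy of its history, and this entropy is at most
twice the sum of `δ^2` over the whole base run; hence `16 * T`. -/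
theorem totalValue_le_add_relEntropy {k₀ k₁ : X → O → ℝ} {δ φ : X → ℝ}
    (hk₀ : ∀ x o, 0 ≤ k₀ x o) (hk₁ : ∀ x o, 0 ≤ k₁ x o) (hk₀1 : ∀ x, ∑ o, k₀ x o = 1)
    (hk₁1 : ∀ x, ∑ o, k₁ x o = 1) (hδ : ∀ x, δ x ≤ 1 / 2)
    (h : ∀ x o, |k₁ x o - k₀ x o| ≤ δ x * k₀ x o) (hφ0 : ∀ x, 0 ≤ φ x) (hφ1 : ∀ x, φ x ≤ 1)
    (σ : (n : ℕ) → (Fin n → O) → X) (T : ℕ) :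
    totalValue k₁ φ σ T ≤ totalValue k₀ φ σ T + T / 8 +
      16 * T * totalValue k₀ (fun x => δ x ^ 2) σ T := by
  have hD : ∀ t ∈ Finset.range T, relEntropy (histProb k₀ σ t) (histProb k₁ σ t) ≤
      2 * totalValue k₀ (fun x => δ x ^ 2) σ T := by
    intro t ht
    refine (relEntropy_histProb_le hk₀ hk₀1 hk₁1 hδ h σ t).trans ?_
    rw [← totalValue_const_mul]
    exact Finset.sum_le_sum_of_subset_of_nonneg
      (Finset.range_mono (Finset.mem_range.1 ht).le) fun s _ _ =>
        Finset.sum_nonneg fun y _ => mul_nonneg (histProb_nonneg hk₀ _ _ _) (by positivity)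
  calc totalValue k₁ φ σ T
      ≤ ∑ t ∈ Finset.range T, (∑ y, histProb k₀ σ t y * φ (σ t y) +
          (1 / 8 + 16 * totalValue k₀ (fun x => δ x ^ 2) σ T)) := by
        refine Finset.sum_le_sum fun t ht => ?_
        have := sum_mul_le_add_relEntropy (φ := fun y => φ (σ t y)) (histProb_nonneg hk₀ σ t)
          (histProb_nonneg hk₁ σ t) (histProb_pos_of_pos hk₀ hδ h σ t) (sum_histProb hk₀1 σ t)
          (sum_histProb hk₁1 σ t) (fun _ => hφ0 _) (fun _ => hφ1 _)
        linarith [hD t ht]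
    _ = _ := by
        rw [Finset.sum_add_distrib, Finset.sum_const, Finset.card_range, nsmul_eq_mul]
        simp only [totalValue]
        ring

/-- A needle-in-a-haystack bound: the environments `i` differ from the base environment only on
costly actions in `hot i`, and only actions in `hot i` are better there. -/
theorem sum_totalValue_le {ι : Type*} [Fintype ι] {k₀ : X → O → ℝ} {k : ι → X → O → ℝ}
    {L₀ : X → ℝ} {L : ι → X → ℝ} {hot : ι → Set X} {costly : Set X} {G ε c δ : ℝ}
    (hk₀ : ∀ x o, 0 ≤ k₀ x o) (hk : ∀ i x o, 0 ≤ k i x o) (hk₀1 : ∀ x, ∑ o, k₀ x o = 1)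
    (hk1 : ∀ i x, ∑ o, k i x o = 1) (hε : 0 ≤ ε) (hc : 0 < c) (hδ : δ ≤ 1 / 2)
    (hdisj : Pairwise fun i j => Disjoint (hot i) (hot j))
    (hclose : ∀ i x o, |k i x o - k₀ x o| ≤ (hot i ∩ costly).indicator (fun _ => δ) x * k₀ x o)
    (hL₀ : ∀ x, L₀ x ≤ G - c * costly.indicator 1 x)
    (hL : ∀ i x, L i x ≤ G + ε * (hot i).indicator 1 x)
    (σ : (n : ℕ) → (Fin n → O) → X) (T : ℕ) :
    ∑ i, totalValue (k i) (L i) σ T + 16 * T * δ ^ 2 * ε / c * totalValue k₀ L₀ σ T ≤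
      (Fintype.card ι + 16 * T * δ ^ 2 * ε / c) * (T * G) +
        ε * T * (1 + Fintype.card ι / 8) := by
  classical
  -- The hot sets are disjoint, so in the base run the visits to all of them together number at most
  -- `T`.
  have hsum : ∀ x, ∑ i, (hot i).indicator (1 : X → ℝ) x ≤ 1 := by
    intro x
    by_cases hx : ∃ i, x ∈ hot i
    · obtain ⟨i, hi⟩ := hx
      rw [Finset.sum_eq_single i]
      · simp [hi]
      · intro j _ hj
        exact Set.indicator_of_notMem (fun h => (hdisj hj).le_bot ⟨h, hi⟩) _
      · simp
    · push Not at hx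
      simp [hx]
  have hind : ∀ (s : Set X) x, 0 ≤ s.indicator (1 : X → ℝ) x := fun s x =>
    Set.indicator_nonneg (fun _ _ => zero_le_one) x
  have hind1 : ∀ (s : Set X) x, s.indicator (1 : X → ℝ) x ≤ 1 := fun s x =>
    Set.indicator_le_self' (fun _ _ => zero_le_one) x
  set n₀ := totalValue k₀ (costly.indicator 1) σ T with hn₀
  -- The weight for which the loss `c * n₀` of the base run cancels exactly the information that
  -- `n₀` costly rounds supply to all environments together.
  set θ := 16 * T * δ ^ 2 * ε / c with hθ
  have hbase : totalValue k₀ L₀ σ T ≤ T * G - c * n₀ := by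
    have := totalValue_mono hk₀ hL₀ σ T
    simp_rw [sub_eq_add_neg, ← neg_mul] at this
    rw [totalValue_add k₀ (fun _ => G) (fun x => -c * costly.indicator 1 x) σ T,
      totalValue_const hk₀1, totalValue_const_mul] at this
    linarith
  have hone : ∀ i, totalValue (k i) (L i) σ T ≤ T * G + ε *
      (totalValue k₀ ((hot i).indicator 1) σ T + T / 8 + 16 * T * (δ ^ 2 *
        totalValue k₀ (fun x => (hot i).indicator 1 x * costly.indicator 1 x) σ T)) := by
    intro i
    have h1 := totalValue_mono (hk i) (hL i) σ T
    rw [totalValue_add (k i) (fun _ => G) (fun x => ε * (hot i).indicator 1 x) σ T,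
      totalValue_const (hk1 i), totalValue_const_mul] at h1
    have h2 := totalValue_le_add_relEntropy hk₀ (hk i) hk₀1 (hk1 i)
      (δ := (hot i ∩ costly).indicator (fun _ => δ)) (φ := (hot i).indicator 1)
      (fun x => by by_cases hx : x ∈ hot i ∩ costly <;> (simp [hx]; try linarith))
      (hclose i) (hind _) (hind1 _) σ T
    have h3 : (fun x => (hot i ∩ costly).indicator (fun _ => δ) x ^ 2) =
        fun x => δ ^ 2 * ((hot i).indicator 1 x * costly.indicator 1 x) := by
      funext x
      by_cases hx : x ∈ hot i <;> by_cases hy : x ∈ costly <;> simp [hx, hy]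
    rw [h3, totalValue_const_mul] at h2
    nlinarith [mul_le_mul_of_nonneg_left h2 hε]
  have hA : ∑ i, totalValue k₀ ((hot i).indicator 1) σ T ≤ T := by
    rw [← totalValue_sum]
    refine (totalValue_mono hk₀ (fun x => hsum x) σ T).trans ?_
    rw [totalValue_const hk₀1, mul_one]
  have hB : ∑ i, totalValue k₀ (fun x => (hot i).indicator 1 x * costly.indicator 1 x) σ T ≤ n₀ := by
    rw [← totalValue_sum]
    refine totalValue_mono hk₀ (fun x => ?_) σ T
    rw [← Finset.sum_mul]
    exact mul_le_of_le_one_left (hind _ _) (hsum x)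
  have hS : ∑ i, totalValue (k i) (L i) σ T ≤ Fintype.card ι * (T * G) + ε *
      (T + Fintype.card ι * (T / 8) + 16 * T * (δ ^ 2 * n₀)) := by
    refine (Finset.sum_le_sum fun i _ => hone i).trans ?_
    simp only [Finset.sum_add_distrib, ← Finset.mul_sum, Finset.sum_const, Finset.card_univ,
      nsmul_eq_mul]
    have := mul_le_mul_of_nonneg_left hB (by positivity : 0 ≤ 16 * (T : ℝ) * δ ^ 2)
    have := mul_le_mul_of_nonneg_left (by linarith :
      ∑ i, totalValue k₀ ((hot i).indicator 1) σ T + Fintype.card ι * ((T : ℝ) / 8) +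
        16 * T * (δ ^ 2 * ∑ i, totalValue k₀
          (fun x => (hot i).indicator 1 x * costly.indicator 1 x) σ T) ≤
      T + Fintype.card ι * ((T : ℝ) / 8) + 16 * T * (δ ^ 2 * n₀)) hε
    linarith
  have hθ0 : 0 ≤ θ := by positivity
  have hθc : θ * c = 16 * T * δ ^ 2 * ε := by rw [hθ]; field_simp
  have h1 := mul_le_mul_of_nonneg_left hbase hθ0
  have h2 : θ * (c * n₀) = 16 * T * δ ^ 2 * ε * n₀ := by rw [← mul_assoc, hθc]
  rw [mul_sub, h2] at h1
  linarith

end TotalValue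

end AdaptiveSampling

/-! ### Measurability of the interaction -/

section Measurability

theorem measurable_twoBit : Measurable fun z : (ℝ × ℝ) × (ℝ × ℝ) => twoBit z.1 z.2 := by
  refine Measurable.prodMk ?_ ?_
  · refine measurable_to_bool ?_
    simpa [Set.preimage] using measurableSet_le measurable_fst.fst measurable_snd.fst
  · refine measurable_to_bool ?_
    simpa [Set.preimage] using measurableSet_le measurable_snd.snd measurable_fst.snd

theorem measurable_trade : Measurable fun z : (ℝ × ℝ) × (ℝ × ℝ) => trade z.1 z.2 :=
  Measurable.ite ((measurableSet_le measurable_fst.fst measurable_snd.fst).inter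
    (measurableSet_le measurable_snd.snd measurable_fst.snd)) measurable_const measurable_const

theorem measurable_gft : Measurable fun z : (ℝ × ℝ) × (ℝ × ℝ) => gft z.1 z.2 :=
  (measurable_fst.snd.sub measurable_fst.fst).mul measurable_trade

theorem measurable_profit : Measurable fun z : (ℝ × ℝ) × (ℝ × ℝ) => profit z.1 z.2 :=
  (measurable_snd.snd.sub measurable_snd.fst).mul measurable_trade

variable {T : ℕ} (A : Mechanism.{u} T)

theorem Mechanism.measurable_price_prod (t : Fin T) :
    Measurable fun z : A.Seed × (Fin (t : ℕ) → Bool × Bool) => A.price t z.1 z.2 :=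
  measurable_from_prod_countable_left fun h => A.measurable_price t h

theorem Mechanism.measurable_history (n : ℕ) (hn : n ≤ T) :
    Measurable fun z : A.Seed × (Fin T → ℝ × ℝ) => A.history z.1 z.2 n hn := by
  induction n with
  | zero => exact measurable_const (a := (Fin.elim0 : Fin 0 → Bool × Bool))
  | succ n ih =>
    have ih := ih (Nat.le_of_succ_le hn)
    refine measurable_pi_iff.2 fun i => ?_
    refine Fin.lastCases ?_ (fun j => ?_) i
    · simp only [history, Fin.snoc_last]
      exact measurable_twoBit.comp (((measurable_pi_apply _).comp measurable_snd).prodMk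
        ((A.measurable_price_prod ⟨n, hn⟩).comp (measurable_fst.prodMk ih)))
    · simp only [history, Fin.snoc_castSucc]
      exact (measurable_pi_apply j).comp ih

theorem Mechanism.measurable_postedPrice (t : Fin T) :
    Measurable fun z : A.Seed × (Fin T → ℝ × ℝ) => A.postedPrice z.1 z.2 t :=
  (A.measurable_price_prod t).comp (measurable_fst.prodMk (A.measurable_history t t.isLt.le))

theorem Mechanism.history_congr (ω : A.Seed) {v v' : Fin T → ℝ × ℝ} (n : ℕ) (hn : n ≤ T)
    (h : ∀ i : Fin T, (i : ℕ) < n → v i = v' i) :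
    A.history ω v n hn = A.history ω v' n hn := by
  induction n with
  | zero => rfl
  | succ n ih =>
    simp only [history]
    rw [ih (Nat.le_of_succ_le hn) fun i hi => h i (hi.trans n.lt_succ_self),
      h ⟨n, hn⟩ n.lt_succ_self]

end Measurability

/-! ### For a fixed seed and i.i.d. values, the feedback is an adaptive sampling process -/

section FixedSeed

variable {T : ℕ} (A : Mechanism.{u} T) (ω : A.Seed)

/-- The pricing strategy of a mechanism for a fixed seed, extended by `0` after round `T`. -/
noncomputable def Mechanism.strategy (n : ℕ) (h : Fin n → Bool × Bool) : ℝ × ℝ :=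
  if hn : n < T then A.price ⟨n, hn⟩ ω h else 0

/-- Law of the feedback on the prices `x` when the values have law `D`. -/
noncomputable def feedbackLaw (D : Measure (ℝ × ℝ)) (x : ℝ × ℝ) (o : Bool × Bool) : ℝ :=
  D.real {v | twoBit v x = o}

theorem measurable_twoBit_left (x : ℝ × ℝ) : Measurable fun v => twoBit v x :=
  measurable_twoBit.comp (measurable_id.prodMk measurable_const)

theorem measurableSet_twoBit_eq (x : ℝ × ℝ) (o : Bool × Bool) :
    MeasurableSet {v | twoBit v x = o} :=
  measurable_twoBit_left x (measurableSet_singleton o)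

theorem sum_feedbackLaw (D : Measure (ℝ × ℝ)) [IsProbabilityMeasure D] (x : ℝ × ℝ) :
    ∑ o, feedbackLaw D x o = 1 := by
  have := sum_measureReal_preimage_singleton (μ := D) (f := fun v => twoBit v x) Finset.univ
    (fun o _ => measurable_twoBit_left x (measurableSet_singleton o))
  simpa [feedbackLaw, Set.preimage] using this

theorem Mechanism.measurable_history_right (n : ℕ) (hn : n ≤ T) :
    Measurable fun v => A.history ω v n hn :=
  (A.measurable_history n hn).comp measurable_prodMk_left

variable {D : Measure (ℝ × ℝ)} [IsProbabilityMeasure D]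

/-- The history before round `t` is a function of the earlier values alone. -/
theorem Mechanism.indepFun_history (t : Fin T) :
    ProbabilityTheory.IndepFun (fun v => A.history ω v t t.isLt.le) (fun v => v t)
      (Measure.pi fun _ : Fin T => D) := by
  classical
  have hind := ProbabilityTheory.iIndepFun_pi (μ := fun _ : Fin T => D)
    (X := fun _ => id) (fun _ => aemeasurable_id)
  have h := hind.indepFun_finset (Finset.univ.filter fun i : Fin T => i < t) {t}
    (by simp) (fun i => measurable_pi_apply i)
  -- Completing the earlier values by 0 writes the history as a function of them; by `history_congr`
  -- the filler does not matter.
  let ext : ((Finset.univ.filter fun i : Fin T => i < t) → ℝ × ℝ) → Fin T → ℝ × ℝ :=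
    fun r i => if hi : i ∈ Finset.univ.filter fun i : Fin T => i < t then r ⟨i, hi⟩ else 0
  have hext : Measurable ext := by
    refine measurable_pi_iff.2 fun i => ?_
    by_cases hi : i ∈ Finset.univ.filter fun i : Fin T => i < t
    · simpa only [ext, hi, dif_pos] using measurable_pi_apply _
    · simpa only [ext, hi, dif_neg, not_false_eq_true] using measurable_const
  have hψ : Measurable fun r : ({t} : Finset (Fin T)) → ℝ × ℝ =>
      r ⟨t, Finset.mem_singleton_self t⟩ := measurable_pi_apply _
  have h2 := h.comp (φ := fun r => A.history ω (ext r) t t.isLt.le)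
    ((A.measurable_history_right ω t _).comp hext) hψ
  refine h2.congr (Filter.EventuallyEq.of_eq ?_) (Filter.EventuallyEq.of_eq rfl)
  funext v
  refine A.history_congr ω _ _ fun i hi => ?_
  simp only [ext, Finset.mem_filter, Finset.mem_univ, true_and, id]
  rw [dif_pos (Fin.lt_def.2 hi)]

/-- Histories are finite in number and independent of the current values, so conditioning on the
history is a finite sum over its possible values. -/
theorem Mechanism.integrable_and_integral_history (t : Fin T)
    (φ : (Fin t → Bool × Bool) → ℝ × ℝ → ℝ) (hφ : ∀ h, Integrable (φ h) D) :
    Integrable (fun v => φ (A.history ω v t t.isLt.le) (v t)) (Measure.pi fun _ : Fin T => D) ∧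
    ∫ v, φ (A.history ω v t t.isLt.le) (v t) ∂(Measure.pi fun _ : Fin T => D) =
      ∑ h, (Measure.pi fun _ : Fin T => D).real {v | A.history ω v t t.isLt.le = h} *
        ∫ x, φ h x ∂D := by
  classical
  set μ := Measure.pi fun _ : Fin T => D with hμ
  have hH := A.measurable_history_right ω t t.isLt.le
  let S : (Fin t → Bool × Bool) → Set (Fin T → ℝ × ℝ) := fun h => {v | A.history ω v t t.isLt.le = h}
  have hS : ∀ h, MeasurableSet (S h) := fun h => hH (measurableSet_singleton h)
  have heq : (fun v => φ (A.history ω v t t.isLt.le) (v t)) =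
      fun v => ∑ h, (S h).indicator (1 : (Fin T → ℝ × ℝ) → ℝ) v * φ h (v t) := by
    funext v
    rw [Finset.sum_eq_single (A.history ω v t t.isLt.le)]
    · simp [S]
    · intro h _ hne
      rw [Set.indicator_of_notMem (fun hv => hne hv.symm), zero_mul]
    · simp
  have hmp : MeasurePreserving (fun v : Fin T → ℝ × ℝ => v t) μ D :=
    measurePreserving_eval (fun _ : Fin T => D) t
  have hint : ∀ h, Integrable (fun v => φ h (v t)) μ := fun h =>
    hmp.integrable_comp_of_integrable (hφ h)
  have hval : ∀ h, ∫ v, φ h (v t) ∂μ = ∫ x, φ h x ∂D := fun h => by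
    rw [← hmp.map_eq, integral_map hmp.measurable.aemeasurable]
    rw [hmp.map_eq]
    exact (hφ h).aestronglyMeasurable
  have hterm : ∀ h, Integrable (fun v => (S h).indicator (1 : (Fin T → ℝ × ℝ) → ℝ) v * φ h (v t)) μ := by
    intro h
    have : (fun v => (S h).indicator (1 : (Fin T → ℝ × ℝ) → ℝ) v * φ h (v t)) =
        (S h).indicator fun v => φ h (v t) := by
      funext v
      by_cases hv : v ∈ S h <;> simp [hv]
    rw [this]
    exact (hint h).indicator (hS h)
  rw [heq]
  refine ⟨integrable_finsetSum _ fun h _ => hterm h, ?_⟩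
  rw [integral_finsetSum _ fun h _ => hterm h]
  refine Finset.sum_congr rfl fun h _ => ?_
  have hind : ProbabilityTheory.IndepFun ((S h).indicator (1 : (Fin T → ℝ × ℝ) → ℝ)) (fun v => φ h (v t)) μ := by
    obtain ⟨g, hg, hge⟩ := (hφ h).aestronglyMeasurable
    have h1 := (A.indepFun_history ω (D := D) t).comp
      (φ := fun y => if y = h then (1 : ℝ) else 0) (ψ := g)
      (measurable_of_countable _) hg.measurable
    refine h1.congr (Filter.EventuallyEq.of_eq ?_) ?_
    · funext v
      simp [S, Set.indicator_apply]
    · exact (hmp.quasiMeasurePreserving.ae_eq_comp hge).symm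
  rw [hind.integral_fun_mul_eq_mul_integral
    ((measurable_one.indicator (hS h)).aestronglyMeasurable) (hint h).aestronglyMeasurable, hval,
    integral_indicator_one (hS h)]

theorem Mechanism.measureReal_history_eq (n : ℕ) (hn : n ≤ T) (h : Fin n → Bool × Bool) :
    (Measure.pi fun _ : Fin T => D).real {v | A.history ω v n hn = h} =
      histProb (feedbackLaw D) (A.strategy ω) n h := by
  classical
  induction n with
  | zero =>
    have : {v | A.history ω v 0 hn = h} = Set.univ := Set.eq_univ_of_forall fun v =>
      Subsingleton.elim _ _
    rw [this, histProb]
    simp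
  | succ n ih =>
    set μ := Measure.pi fun _ : Fin T => D
    let B : Set (ℝ × ℝ) := {x | twoBit x (A.strategy ω n (Fin.init h)) = h (Fin.last n)}
    let φ : (Fin n → Bool × Bool) → ℝ × ℝ → ℝ := fun y =>
      if y = Fin.init h then B.indicator 1 else 0
    have hB : MeasurableSet B := measurableSet_twoBit_eq _ _
    have hφ : ∀ y, Integrable (φ y) D := fun y => by
      by_cases hy : y = Fin.init h
      · have := (integrable_const (μ := D) (1 : ℝ)).indicator hB
        simp only [φ, hy, if_true]
        exact this
      · simp [φ, hy]
    have key := (A.integrable_and_integral_history ω ⟨n, hn⟩ φ hφ).2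
    have hset : (fun v : Fin T → ℝ × ℝ => φ (A.history ω v n (Nat.le_of_succ_le hn)) (v ⟨n, hn⟩)) =
        {v | A.history ω v (n + 1) hn = h}.indicator 1 := by
      funext v
      have hiff : A.history ω v (n + 1) hn = h ↔
          A.history ω v n (Nat.le_of_succ_le hn) = Fin.init h ∧ v ⟨n, hn⟩ ∈ B := by
        conv_lhs => rw [← Fin.snoc_init_self h]
        simp only [history]
        rw [Fin.snoc_inj]
        refine and_congr_right fun h1 => ?_
        have : n < T := hn
        simp [B, strategy, h1, this]
      by_cases h1 : A.history ω v n (Nat.le_of_succ_le hn) = Fin.init h <;>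
        by_cases h2 : v ⟨n, hn⟩ ∈ B <;> simp [φ, h1, h2, hiff]
    have hmeas : MeasurableSet {v | A.history ω v (n + 1) hn = h} :=
      A.measurable_history_right ω (n + 1) hn (measurableSet_singleton h)
    simp only [hset] at key
    rw [integral_indicator_one hmeas] at key
    rw [key, Finset.sum_eq_single (Fin.init h)]
    · simp only [φ, if_true]
      rw [integral_indicator_one hB, ih]
      rfl
    · intro y _ hy
      simp [φ, hy]
    · simp

end FixedSeed

/-- Gains from trade plus a multiple of the profit. -/
noncomputable def lagrangian (l : ℝ) (v x : ℝ × ℝ) : ℝ := gft v x + l * profit v x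

/-! ### From regret to Lagrangian values -/

section Value

variable {D : Measure (ℝ × ℝ)}

theorem trade_nonneg (v x : ℝ × ℝ) : 0 ≤ trade v x := by
  unfold trade; split_ifs <;> norm_num

theorem trade_le_one (v x : ℝ × ℝ) : trade v x ≤ 1 := by
  unfold trade; split_ifs <;> norm_num

theorem abs_gft_le_one {v : ℝ × ℝ} (hv : v ∈ Set.Icc (0 : ℝ) 1 ×ˢ Set.Icc (0 : ℝ) 1)
    (x : ℝ × ℝ) : |gft v x| ≤ 1 := by
  obtain ⟨⟨h1, h2⟩, h3, h4⟩ := hv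
  rw [gft, abs_mul, abs_of_nonneg (trade_nonneg v x)]
  exact mul_le_one₀ (abs_le.2 ⟨by linarith, by linarith⟩) (trade_nonneg v x) (trade_le_one v x)

theorem profit_le_one {v : ℝ × ℝ} (hv : v ∈ Set.Icc (0 : ℝ) 1 ×ˢ Set.Icc (0 : ℝ) 1)
    (x : ℝ × ℝ) : profit v x ≤ 1 := by
  obtain ⟨⟨h1, h2⟩, h3, h4⟩ := hv
  unfold profit trade
  split_ifs with h
  · linarith [h.1, h.2]
  · simp

theorem integrable_gft (hD : IsValueLaw D) (x : ℝ × ℝ) : Integrable (fun v => gft v x) D :=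
  have := hD.1
  Integrable.of_bound (measurable_gft.comp (measurable_id.prodMk measurable_const)).aestronglyMeasurable
    1 (hD.2.mono fun _ hv => abs_gft_le_one hv x)

theorem integrable_profit (hD : IsValueLaw D) (x : ℝ × ℝ) : Integrable (fun v => profit v x) D := by
  have := hD.1
  refine Integrable.of_bound
    (measurable_profit.comp (measurable_id.prodMk measurable_const)).aestronglyMeasurable
    |x.2 - x.1| (Filter.Eventually.of_forall fun v => ?_)
  rw [profit, Real.norm_eq_abs, abs_mul, abs_of_nonneg (trade_nonneg v x)]
  exact mul_le_of_le_one_right (abs_nonneg _) (trade_le_one v x)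

theorem integrable_lagrangian (hD : IsValueLaw D) (l : ℝ) (x : ℝ × ℝ) :
    Integrable (fun v => lagrangian l v x) D :=
  (integrable_gft hD x).add ((integrable_profit hD x).const_mul l)

variable {T : ℕ} (A : Mechanism.{u} T)

theorem Mechanism.integral_sum_lagrangian (hD : IsValueLaw D) (l : ℝ) (ω : A.Seed) :
    ∫ v, ∑ t, lagrangian l (v t) (A.postedPrice ω v t) ∂(Measure.pi fun _ : Fin T => D) =
      totalValue (feedbackLaw D) (fun x => ∫ v, lagrangian l v x ∂D) (A.strategy ω) T := by
  have := hD.1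
  have key : ∀ t : Fin T, _ := fun t => A.integrable_and_integral_history ω (D := D) t
    (fun h x => lagrangian l x (A.price t ω h)) fun h => integrable_lagrangian hD l _
  simp only [postedPrice]
  rw [integral_finsetSum _ fun t _ => (key t).1, totalValue, Finset.sum_range]
  refine Finset.sum_congr rfl fun t _ => ?_
  rw [(key t).2]
  refine Finset.sum_congr rfl fun h _ => ?_
  rw [A.measureReal_history_eq ω t t.isLt.le]
  simp [strategy]

theorem pi_mem_adversarialValues (hD : IsValueLaw D) (T : ℕ) :
    (Measure.pi fun _ : Fin T => D) ∈ adversarialValues T := by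
  have := hD.1
  refine ⟨inferInstance, ?_⟩
  rw [ae_all_iff]
  intro t
  exact (Measure.tendsto_eval_ae_ae (μ := fun _ : Fin T => D) (i := t)).eventually hD.2

theorem correlatedValues_subset (T : ℕ) : correlatedValues T ⊆ adversarialValues T := by
  rintro _ ⟨D, hD, rfl⟩
  exact pi_mem_adversarialValues hD T

theorem densityBoundedCorrelatedValues_subset (T : ℕ) (M : ℝ≥0) :
    densityBoundedCorrelatedValues T M ⊆ correlatedValues T := by
  rintro _ ⟨D, hD, -, rfl⟩
  exact ⟨D, hD, rfl⟩

theorem ae_prod_snd {Ω V : Type*} [MeasurableSpace Ω] [MeasurableSpace V] {ν : Measure Ω}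
    {μ : Measure V} [SFinite μ] {p : V → Prop} (h : ∀ᵐ v ∂μ, p v) : ∀ᵐ z ∂(ν.prod μ), p z.2 :=
  Measure.quasiMeasurePreserving_snd.ae h

/-- Weak duality for the budget constraint. Prices are arbitrary reals, so profit in a single round
has no lower bound; the total is integrable because budget balance bounds it below by 0, and a trade
at values in `[0, 1]` yields profit at most 1. -/
theorem Mechanism.integrable_and_totalGFT_le {μ : Measure (Fin T → ℝ × ℝ)}
    (hμ : μ ∈ adversarialValues T) {l : ℝ} (hl : 0 ≤ l)
    (hbb : ∀ᵐ z ∂(A.seedLaw.prod μ), 0 ≤ ∑ t, profit (z.2 t) (A.postedPrice z.1 z.2 t)) :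
    Integrable (fun z => ∑ t, lagrangian l (z.2 t) (A.postedPrice z.1 z.2 t))
      (A.seedLaw.prod μ) ∧
    A.totalGFT μ ≤ ∫ z, ∑ t, lagrangian l (z.2 t) (A.postedPrice z.1 z.2 t)
      ∂(A.seedLaw.prod μ) := by
  have := hμ.1
  have hv := ae_prod_snd (ν := A.seedLaw) hμ.2
  have hmeas : ∀ t : Fin T, Measurable fun z : A.Seed × (Fin T → ℝ × ℝ) =>
      (z.2 t, A.postedPrice z.1 z.2 t) := fun t =>
    ((measurable_pi_apply t).comp measurable_snd).prodMk (A.measurable_postedPrice t)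
  have hg : Integrable (fun z => ∑ t, gft (z.2 t) (A.postedPrice z.1 z.2 t))
      (A.seedLaw.prod μ) := by
    refine integrable_finsetSum _ fun t _ => ?_
    exact Integrable.of_bound (measurable_gft.comp (hmeas t)).aestronglyMeasurable 1
      (hv.mono fun z hz => abs_gft_le_one (hz t) _)
  have hp : Integrable (fun z => ∑ t, profit (z.2 t) (A.postedPrice z.1 z.2 t))
      (A.seedLaw.prod μ) := by
    refine Integrable.of_bound (C := T) (Measurable.aestronglyMeasurable
      (Finset.measurable_sum _ fun t _ => measurable_profit.comp (hmeas t))) ?_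
    filter_upwards [hv, hbb] with z hz hz0
    rw [Real.norm_eq_abs, abs_of_nonneg hz0]
    exact (Finset.sum_le_sum fun t _ => profit_le_one (hz t) _).trans (by simp)
  have heq : (fun z : A.Seed × (Fin T → ℝ × ℝ) =>
      ∑ t, lagrangian l (z.2 t) (A.postedPrice z.1 z.2 t)) =
      fun z => ∑ t, gft (z.2 t) (A.postedPrice z.1 z.2 t) +
        l * ∑ t, profit (z.2 t) (A.postedPrice z.1 z.2 t) := by
    funext z
    simp [lagrangian, Finset.sum_add_distrib, Finset.mul_sum]
  rw [heq]
  refine ⟨hg.add (hp.const_mul l), ?_⟩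
  rw [integral_add hg (hp.const_mul l), integral_const_mul]
  have : 0 ≤ ∫ z, ∑ t, profit (z.2 t) (A.postedPrice z.1 z.2 t) ∂(A.seedLaw.prod μ) :=
    integral_nonneg_of_ae hbb
  have := mul_nonneg hl this
  unfold totalGFT
  linarith

/-- Fubini separates the seed from the values, so the bounds for deterministic strategies apply seed
by seed. -/
theorem Mechanism.totalGFT_le_integral_totalValue (hD : IsValueLaw D) {l : ℝ} (hl : 0 ≤ l)
    (hbb : ∀ᵐ z ∂(A.seedLaw.prod (Measure.pi fun _ : Fin T => D)),
      0 ≤ ∑ t, profit (z.2 t) (A.postedPrice z.1 z.2 t)) :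
    Integrable (fun ω => totalValue (feedbackLaw D) (fun x => ∫ v, lagrangian l v x ∂D)
      (A.strategy ω) T) A.seedLaw ∧
    A.totalGFT (Measure.pi fun _ => D) ≤ ∫ ω, totalValue (feedbackLaw D)
      (fun x => ∫ v, lagrangian l v x ∂D) (A.strategy ω) T ∂A.seedLaw := by
  have := hD.1
  obtain ⟨h1, h2⟩ := A.integrable_and_totalGFT_le (pi_mem_adversarialValues hD T) hl hbb
  rw [integral_prod _ h1] at h2
  have h3 := h1.integral_prod_left
  simp only [A.integral_sum_lagrangian hD] at h2 h3
  exact ⟨h3, h2⟩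

theorem abs_integral_sum_gft_le {μ : Measure (Fin T → ℝ × ℝ)} (hμ : μ ∈ adversarialValues T)
    (x : ℝ × ℝ) : |∫ v, ∑ t, gft (v t) x ∂μ| ≤ T := by
  have := hμ.1
  have := norm_integral_le_of_norm_le_const (μ := μ) (f := fun v => ∑ t, gft (v t) x) (C := T)
    (hμ.2.mono fun v hv => (norm_sum_le _ _).trans
      ((Finset.sum_le_sum fun t _ => abs_gft_le_one (hv t) x).trans (by simp)))
  simpa using this

theorem bddAbove_gft {μ : Measure (Fin T → ℝ × ℝ)} (hμ : μ ∈ adversarialValues T) :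
    BddAbove ((fun x : ℝ × ℝ => ∫ v, ∑ t, gft (v t) x ∂μ) ''
      {x | 0 ≤ x.1 ∧ x.1 ≤ x.2 ∧ x.2 ≤ 1}) := by
  refine ⟨T, ?_⟩
  rintro _ ⟨x, -, rfl⟩
  exact (le_abs_self _).trans (abs_integral_sum_gft_le hμ x)

/-- The crude bound makes the set of regrets bounded above, without which its `sSup` would be the
junk value 0. -/
theorem Mechanism.regret_le {μ : Measure (Fin T → ℝ × ℝ)} (hμ : μ ∈ adversarialValues T) :
    A.regret μ ≤ 2 * T := by
  have := hμ.1
  have h1 : optimalGFT μ ≤ T := by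
    refine csSup_le (Set.Nonempty.image _ ⟨(0, 0), by simp⟩) ?_
    rintro _ ⟨x, -, rfl⟩
    exact (le_abs_self _).trans (abs_integral_sum_gft_le hμ x)
  have h2 := norm_integral_le_of_norm_le_const (μ := A.seedLaw.prod μ)
    (f := fun z => ∑ t, gft (z.2 t) (A.postedPrice z.1 z.2 t)) (C := T)
    ((ae_prod_snd hμ.2).mono fun z hz => (norm_sum_le _ _).trans
      ((Finset.sum_le_sum fun t _ => abs_gft_le_one (hz t) _).trans (by simp)))
  have h3 : -(T : ℝ) ≤ A.totalGFT μ := (abs_le.1 (by simpa [totalGFT] using h2)).1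
  unfold regret
  linarith

theorem Mechanism.regret_le_worstCaseRegret {𝒟 : Set (Measure (Fin T → ℝ × ℝ))}
    (h𝒟 : 𝒟 ⊆ adversarialValues T) {μ : Measure (Fin T → ℝ × ℝ)} (hμ : μ ∈ 𝒟) :
    A.regret μ ≤ A.worstCaseRegret 𝒟 := by
  refine le_csSup ⟨2 * T, ?_⟩ ⟨μ, hμ, rfl⟩
  rintro _ ⟨μ', hμ', rfl⟩
  exact A.regret_le (h𝒟 hμ')

theorem mul_integral_gft_le_optimalGFT (hD : IsValueLaw D) (T : ℕ) {x : ℝ × ℝ} (h0 : 0 ≤ x.1)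
    (h1 : x.1 ≤ x.2) (h2 : x.2 ≤ 1) :
    T * ∫ v, gft v x ∂D ≤ optimalGFT (Measure.pi fun _ : Fin T => D) := by
  have := hD.1
  refine le_csSup_of_le (bddAbove_gft (pi_mem_adversarialValues hD T)) ⟨x, ⟨h0, h1, h2⟩, rfl⟩ ?_
  have hmp : ∀ t : Fin T, MeasurePreserving (fun v : Fin T → ℝ × ℝ => v t)
      (Measure.pi fun _ : Fin T => D) D := fun t => measurePreserving_eval (fun _ : Fin T => D) t
  have hI := integrable_gft hD x
  have hval : ∀ t : Fin T, ∫ v, gft (v t) x ∂(Measure.pi fun _ : Fin T => D) =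
      ∫ y, gft y x ∂D := fun t => by
    conv_rhs => rw [← (hmp t).map_eq]
    rw [integral_map (hmp t).measurable.aemeasurable]
    rw [(hmp t).map_eq]
    exact hI.aestronglyMeasurable
  have hI' : ∀ t ∈ Finset.univ, Integrable (fun v : Fin T → ℝ × ℝ => gft (v t) x)
      (Measure.pi fun _ : Fin T => D) := fun t _ => (hmp t).integrable_comp_of_integrable hI
  simp [integral_finsetSum _ hI', hval]

end Value

/-! ### Indicators of intervals and their integrals over half-lines -/

section Segments

/-- Indicator function of `(a, b]`. -/
noncomputable def seg (a b : ℝ) : ℝ → ℝ := (Set.Ioc a b).indicator 1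

/-- Functions on the line with all moments. -/
def HasMoments (u : ℝ → ℝ) : Prop := ∀ k : ℕ, Integrable fun x => x ^ k * u x

theorem hasMoments_seg (a b : ℝ) : HasMoments (seg a b) := by
  intro k
  have h : (fun x => x ^ k * seg a b x) = (Set.Ioc a b).indicator fun x => x ^ k := by
    funext x
    by_cases hx : x ∈ Set.Ioc a b <;> simp [seg, hx]
  rw [h, integrable_indicator_iff measurableSet_Ioc]
  exact ((continuous_pow k).integrableOn_Icc (a := a) (b := b)).mono_set Set.Ioc_subset_Icc_self

theorem HasMoments.sub {u v : ℝ → ℝ} (hu : HasMoments u) (hv : HasMoments v) :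
    HasMoments fun x => u x - v x := by
  intro k
  simp only [mul_sub]
  exact (hu k).sub (hv k)

theorem HasMoments.const_mul {u : ℝ → ℝ} (hu : HasMoments u) (c : ℝ) :
    HasMoments fun x => c * u x := by
  intro k
  simpa only [mul_left_comm] using (hu k).const_mul c

theorem HasMoments.id_mul {u : ℝ → ℝ} (hu : HasMoments u) : HasMoments fun x => x * u x := by
  intro k
  simpa only [pow_succ, mul_assoc] using hu (k + 1)

theorem HasMoments.integrable {u : ℝ → ℝ} (hu : HasMoments u) : Integrable u := by
  simpa using hu 0

theorem seg_nonneg (a b x : ℝ) : 0 ≤ seg a b x := Set.indicator_nonneg (fun _ _ => zero_le_one) x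

theorem seg_le_one (a b x : ℝ) : seg a b x ≤ 1 :=
  Set.indicator_le_self' (fun _ _ => zero_le_one) x

theorem seg_of_mem {a b x : ℝ} (h1 : a < x) (h2 : x ≤ b) : seg a b x = 1 :=
  Set.indicator_of_mem (Set.mem_Ioc.2 ⟨h1, h2⟩) _

theorem seg_of_le {a b x : ℝ} (h : x ≤ a) : seg a b x = 0 :=
  Set.indicator_of_notMem (fun hx => h.not_gt hx.1) _

theorem seg_of_lt {a b x : ℝ} (h : b < x) : seg a b x = 0 :=
  Set.indicator_of_notMem (fun hx => h.not_ge hx.2) _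

theorem seg_add_seg {a b c : ℝ} (hab : a ≤ b) (hbc : b ≤ c) (x : ℝ) :
    seg a b x + seg b c x = seg a c x := by
  rcases le_or_gt x a with h | h
  · rw [seg_of_le h, seg_of_le (h.trans hab), seg_of_le h, add_zero]
  rcases le_or_gt x b with h' | h'
  · rw [seg_of_mem h h', seg_of_le h', seg_of_mem h (h'.trans hbc), add_zero]
  rcases le_or_gt x c with h'' | h''
  · rw [seg_of_lt h', seg_of_mem h' h'', seg_of_mem h h'', zero_add]
  · rw [seg_of_lt h', seg_of_lt h'', seg_of_lt h'', zero_add]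

theorem measurable_seg (a b : ℝ) : Measurable (seg a b) :=
  measurable_one.indicator measurableSet_Ioc

/-- Nearest point of `[a, b]`. -/
noncomputable def clamp (a b x : ℝ) : ℝ := max a (min b x)

theorem clamp_of_le {a b x : ℝ} (h : x ≤ a) : clamp a b x = a :=
  max_eq_left ((min_le_right _ _).trans h)

theorem clamp_of_ge {a b x : ℝ} (hab : a ≤ b) (h : b ≤ x) : clamp a b x = b := by
  rw [clamp, min_eq_left h, max_eq_right hab]

theorem clamp_of_mem {a b x : ℝ} (h1 : a ≤ x) (h2 : x ≤ b) : clamp a b x = x := by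
  rw [clamp, min_eq_right h2, max_eq_right h1]

theorem setIntegral_mul_seg (A : Set ℝ) (g : ℝ → ℝ) (a b : ℝ) :
    ∫ x in A, g x * seg a b x = ∫ x in A ∩ Set.Ioc a b, g x := by
  have h : (fun x => g x * seg a b x) = (Set.Ioc a b).indicator g := by
    funext x
    by_cases hx : x ∈ Set.Ioc a b <;> simp [seg, hx]
  rw [h, setIntegral_indicator measurableSet_Ioc]

theorem setIntegral_Iic_mul_seg (g : ℝ → ℝ) (a b p : ℝ) :
    ∫ x in Set.Iic p, g x * seg a b x = ∫ x in a..clamp a b p, g x := by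
  rw [setIntegral_mul_seg,
    clamp,
    intervalIntegral.integral_of_le (le_max_left _ _)]
  congr 2
  ext x
  simp only [Set.mem_inter_iff, Set.mem_Iic, Set.mem_Ioc, le_max_iff, le_min_iff]
  grind

theorem setIntegral_Ici_mul_seg (g : ℝ → ℝ) {a b : ℝ} (hab : a ≤ b) (q : ℝ) :
    ∫ x in Set.Ici q, g x * seg a b x = ∫ x in clamp a b q..b, g x := by
  rw [integral_Ici_eq_integral_Ioi, setIntegral_mul_seg,
    clamp,
    intervalIntegral.integral_of_le (max_le hab (min_le_left _ _))]
  congr 2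
  ext x
  simp only [Set.mem_inter_iff, Set.mem_Ioi, Set.mem_Ioc, max_lt_iff, min_lt_iff]
  grind

theorem setIntegral_Iic_seg (a b p : ℝ) : ∫ x in Set.Iic p, seg a b x = clamp a b p - a := by
  simpa using setIntegral_Iic_mul_seg (fun _ => 1) a b p

theorem setIntegral_Ici_seg {a b : ℝ} (hab : a ≤ b) (q : ℝ) :
    ∫ x in Set.Ici q, seg a b x = b - clamp a b q := by
  simpa using setIntegral_Ici_mul_seg (fun _ => 1) hab q

theorem setIntegral_Iic_id_mul_seg (a b p : ℝ) :
    ∫ x in Set.Iic p, x * seg a b x = (clamp a b p ^ 2 - a ^ 2) / 2 := by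
  simpa using setIntegral_Iic_mul_seg (fun x => x) a b p

theorem setIntegral_Ici_id_mul_seg {a b : ℝ} (hab : a ≤ b) (q : ℝ) :
    ∫ x in Set.Ici q, x * seg a b x = (b ^ 2 - clamp a b q ^ 2) / 2 := by
  simpa using setIntegral_Ici_mul_seg (fun x => x) hab q

theorem integral_seg {a b : ℝ} (hab : a ≤ b) : ∫ x, seg a b x = b - a := by
  have : ∫ x, seg a b x = ∫ x in Set.Ioc a b, (1 : ℝ) := by
    rw [← integral_indicator measurableSet_Ioc]; rfl
  simp [this, hab]

theorem setIntegral_Ioi_eq {u : ℝ → ℝ} (hu : Integrable u) (p : ℝ) :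
    ∫ x in Set.Ioi p, u x = (∫ x, u x) - ∫ x in Set.Iic p, u x := by
  have := integral_add_compl (measurableSet_Iic (a := p)) hu
  rw [Set.compl_Iic] at this
  linarith

theorem setIntegral_Iio_eq {u : ℝ → ℝ} (hu : Integrable u) (q : ℝ) :
    ∫ x in Set.Iio q, u x = (∫ x, u x) - ∫ x in Set.Ici q, u x := by
  have := integral_add_compl (measurableSet_Ici (a := q)) hu
  rw [Set.compl_Ici] at this
  linarith

end Segments

/-! ### Integrals of product functions over rectangles -/

section Products

/-- `f` is integrable on `S`, with integral `I`. -/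
def HasSetIntegral (f : ℝ × ℝ → ℝ) (S : Set (ℝ × ℝ)) (I : ℝ) : Prop :=
  IntegrableOn f S ∧ ∫ z in S, f z = I

theorem HasSetIntegral.add {f g : ℝ × ℝ → ℝ} {S : Set (ℝ × ℝ)} {I J : ℝ}
    (hf : HasSetIntegral f S I) (hg : HasSetIntegral g S J) :
    HasSetIntegral (fun z => f z + g z) S (I + J) :=
  ⟨hf.1.add hg.1, by rw [integral_add hf.1 hg.1, hf.2, hg.2]⟩

theorem HasSetIntegral.const_mul {f : ℝ × ℝ → ℝ} {S : Set (ℝ × ℝ)} {I : ℝ}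
    (hf : HasSetIntegral f S I) (c : ℝ) : HasSetIntegral (fun z => c * f z) S (c * I) :=
  ⟨hf.1.const_mul c, by rw [integral_const_mul, hf.2]⟩

theorem hasSetIntegral_prod_mul {u v : ℝ → ℝ} (hu : Integrable u) (hv : Integrable v)
    (A B : Set ℝ) : HasSetIntegral (fun z => u z.1 * v z.2) (A ×ˢ B)
      ((∫ x in A, u x) * ∫ x in B, v x) :=
  ⟨(hu.mul_prod hv).integrableOn, setIntegral_prod_mul u v A B⟩

theorem hasSetIntegral_prod_mul_weight {u v : ℝ → ℝ} (hu : HasMoments u) (hv : HasMoments v)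
    (A B : Set ℝ) (c : ℝ) :
    HasSetIntegral (fun z => u z.1 * v z.2 * (z.2 - z.1 + c)) (A ×ˢ B)
      ((∫ x in A, u x) * (∫ x in B, x * v x) - (∫ x in A, x * u x) * (∫ x in B, v x) +
        c * ((∫ x in A, u x) * ∫ x in B, v x)) := by
  have h1 := hasSetIntegral_prod_mul hu.integrable hv.id_mul.integrable A B
  have h2 := (hasSetIntegral_prod_mul hu.id_mul.integrable hv.integrable A B).const_mul (-1)
  have h3 := (hasSetIntegral_prod_mul hu.integrable hv.integrable A B).const_mul c
  convert (h1.add h2).add h3 using 1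
  · funext z; ring
  · ring

end Products

/-! ### The hard densities: bounds and support -/

section HardDensity

/-- `1` on the lower half and `-1` on the upper half of `(0, 3/8]`. -/
noncomputable def lowSign (x : ℝ) : ℝ := seg 0 (3 / 16) x - seg (3 / 16) (3 / 8) x

/-- `1` on the upper half and `-1` on the lower half of `(5/8, 1]`. -/
noncomputable def highSign (x : ℝ) : ℝ := seg (13 / 16) 1 x - seg (5 / 8) (13 / 16) x

/-- `x - 1/2` on `(7/16, 9/16]`. -/
noncomputable def midLin (x : ℝ) : ℝ := x * seg (7 / 16) (9 / 16) x - 1 / 2 * seg (7 / 16) (9 / 16) x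

/-- `1` on the upper half and `-1` on the lower half of `(a, a + w]`. -/
noncomputable def cellSign (a w x : ℝ) : ℝ := seg (a + w / 2) (a + w) x - seg a (a + w / 2) x

/-- The density of the hard instances: all prices `p = q` in `[7/16, 9/16]` are optimal for
`r = 0`; for `r = 1/2` the price `a + w / 2` is better. -/
noncomputable def hardDensity (r a w : ℝ) (z : ℝ × ℝ) : ℝ :=
  8 / 3 * (seg 0 (3 / 8) z.1 * seg (7 / 16) (9 / 16) z.2) +
  -(256 / 9) * (lowSign z.1 * midLin z.2) +
  8 / 3 * (seg (7 / 16) (9 / 16) z.1 * seg (5 / 8) 1 z.2) +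
  256 / 9 * (midLin z.1 * highSign z.2) +
  192 * (seg (3 / 8) (7 / 16) z.1 * seg (9 / 16) (5 / 8) z.2) +
  r * (lowSign z.1 * cellSign a w z.2)

theorem hasMoments_lowSign : HasMoments lowSign := (hasMoments_seg _ _).sub (hasMoments_seg _ _)

theorem hasMoments_highSign : HasMoments highSign := (hasMoments_seg _ _).sub (hasMoments_seg _ _)

theorem hasMoments_midLin : HasMoments midLin :=
  (hasMoments_seg _ _).id_mul.sub ((hasMoments_seg _ _).const_mul _)

theorem hasMoments_cellSign (a w : ℝ) : HasMoments (cellSign a w) :=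
  (hasMoments_seg _ _).sub (hasMoments_seg _ _)

theorem measurable_hardDensity (r a w : ℝ) : Measurable (hardDensity r a w) := by
  have h := fun a b => measurable_seg a b
  unfold hardDensity lowSign highSign midLin cellSign
  fun_prop

theorem abs_seg_sub_seg_le {a b c : ℝ} (hab : a ≤ b) (hbc : b ≤ c) (x : ℝ) :
    |seg a b x - seg b c x| ≤ seg a c x := by
  rw [← seg_add_seg hab hbc, abs_le]
  constructor <;> linarith [seg_nonneg a b x, seg_nonneg b c x]

theorem abs_lowSign_le (x : ℝ) : |lowSign x| ≤ seg 0 (3 / 8) x :=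
  abs_seg_sub_seg_le (by norm_num) (by norm_num) x

theorem abs_highSign_le (x : ℝ) : |highSign x| ≤ seg (5 / 8) 1 x := by
  rw [highSign, abs_sub_comm]
  exact abs_seg_sub_seg_le (by norm_num) (by norm_num) x

theorem abs_cellSign_le {a w : ℝ} (hw : 0 ≤ w) (x : ℝ) : |cellSign a w x| ≤ seg a (a + w) x := by
  rw [cellSign, abs_sub_comm]
  exact abs_seg_sub_seg_le (by linarith) (by linarith) x

theorem seg_le_seg {a b c d : ℝ} (h1 : c ≤ a) (h2 : b ≤ d) (x : ℝ) : seg a b x ≤ seg c d x :=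
  Set.indicator_le_indicator_of_subset (Set.Ioc_subset_Ioc h1 h2) (fun _ => zero_le_one) x

theorem abs_midLin_le (x : ℝ) : |midLin x| ≤ 1 / 16 * seg (7 / 16) (9 / 16) x := by
  by_cases hx : x ∈ Set.Ioc (7 / 16 : ℝ) (9 / 16)
  · rw [midLin, seg_of_mem hx.1 hx.2, abs_le]
    constructor <;> linarith [hx.1, hx.2]
  · simp [midLin, seg, hx]

variable {r a w : ℝ}

theorem abs_cellSign_le_mid (hw : 0 ≤ w) (ha : 1 / 2 - 1 / 48 ≤ a) (haw : a + w ≤ 1 / 2 + 1 / 48)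
    (x : ℝ) : |cellSign a w x| ≤ seg (7 / 16) (9 / 16) x :=
  (abs_cellSign_le hw x).trans (seg_le_seg (by linarith) (by linarith) x)

/-- The signed terms live on the same rectangles as the uniform blocks; `256/9` times the bound 1/16
on `midLin` gives 16/9. -/
theorem abs_sub_hardDensity_le (hw : 0 ≤ w) (ha : 1 / 2 - 1 / 48 ≤ a)
    (haw : a + w ≤ 1 / 2 + 1 / 48) (hr0 : 0 ≤ r) (z : ℝ × ℝ) :
    |hardDensity r a w z - (8 / 3 * (seg 0 (3 / 8) z.1 * seg (7 / 16) (9 / 16) z.2) +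
      8 / 3 * (seg (7 / 16) (9 / 16) z.1 * seg (5 / 8) 1 z.2) +
      192 * (seg (3 / 8) (7 / 16) z.1 * seg (9 / 16) (5 / 8) z.2))| ≤
      (16 / 9 + r) * (seg 0 (3 / 8) z.1 * seg (7 / 16) (9 / 16) z.2) +
      16 / 9 * (seg (7 / 16) (9 / 16) z.1 * seg (5 / 8) 1 z.2) := by
  have h1 := mul_le_mul (abs_lowSign_le z.1) (abs_midLin_le z.2) (abs_nonneg _) (seg_nonneg _ _ _)
  have h2 := mul_le_mul (abs_midLin_le z.1) (abs_highSign_le z.2) (abs_nonneg _)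
    (by have := seg_nonneg (7 / 16) (9 / 16) z.1; linarith)
  have h3 := mul_le_mul (abs_lowSign_le z.1) (abs_cellSign_le_mid hw ha haw z.2) (abs_nonneg _)
    (seg_nonneg _ _ _)
  rw [← abs_mul] at h1 h2 h3
  have h4 := mul_le_mul_of_nonneg_left h3 hr0
  rw [← abs_of_nonneg hr0, ← abs_mul, abs_of_nonneg hr0] at h4
  rw [abs_le] at h1 h2 h4 ⊢
  unfold hardDensity
  constructor <;> linarith [h1.1, h1.2, h2.1, h2.2, h4.1, h4.2]

/-- The remaining mass `8/9 = 8/3 - 16/9` gives positivity for `r ≤ 1/2`, and for `r = 0` bounds the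
base outcome probabilities from below. -/
theorem low_mul_mid_le_hardDensity (hw : 0 ≤ w) (ha : 1 / 2 - 1 / 48 ≤ a)
    (haw : a + w ≤ 1 / 2 + 1 / 48) (hr0 : 0 ≤ r) (z : ℝ × ℝ) :
    (8 / 9 - r) * (seg 0 (3 / 8) z.1 * seg (7 / 16) (9 / 16) z.2) ≤ hardDensity r a w z := by
  have h := (abs_le.1 (abs_sub_hardDensity_le hw ha haw hr0 z)).1
  have h1 := mul_nonneg (seg_nonneg (7 / 16) (9 / 16) z.1) (seg_nonneg (5 / 8) 1 z.2)
  have h2 := mul_nonneg (seg_nonneg (3 / 8) (7 / 16) z.1) (seg_nonneg (9 / 16) (5 / 8) z.2)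
  linarith

theorem hardDensity_nonneg (hw : 0 ≤ w) (ha : 1 / 2 - 1 / 48 ≤ a)
    (haw : a + w ≤ 1 / 2 + 1 / 48) (hr0 : 0 ≤ r) (hr : r ≤ 1 / 2) (z : ℝ × ℝ) :
    0 ≤ hardDensity r a w z :=
  (mul_nonneg (by linarith) (mul_nonneg (seg_nonneg _ _ _) (seg_nonneg _ _ _))).trans
    (low_mul_mid_le_hardDensity hw ha haw hr0 z)

/-- The blocks are treated as if they overlapped: 192 plus less than 10. -/
theorem hardDensity_le (hw : 0 ≤ w) (ha : 1 / 2 - 1 / 48 ≤ a)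
    (haw : a + w ≤ 1 / 2 + 1 / 48) (hr0 : 0 ≤ r) (hr : r ≤ 1 / 2) (z : ℝ × ℝ) :
    hardDensity r a w z ≤ 224 := by
  have h := (abs_le.1 (abs_sub_hardDensity_le hw ha haw hr0 z)).2
  have h0 := mul_le_one₀ (seg_le_one 0 (3 / 8) z.1) (seg_nonneg (7 / 16) (9 / 16) z.2)
    (seg_le_one _ _ _)
  have h1 := mul_le_one₀ (seg_le_one (7 / 16) (9 / 16) z.1) (seg_nonneg (5 / 8) 1 z.2)
    (seg_le_one _ _ _)
  have h2 := mul_le_one₀ (seg_le_one (3 / 8) (7 / 16) z.1) (seg_nonneg (9 / 16) (5 / 8) z.2)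
    (seg_le_one _ _ _)
  have h3 := mul_nonneg (seg_nonneg 0 (3 / 8) z.1) (seg_nonneg (7 / 16) (9 / 16) z.2)
  have h4 := mul_le_mul_of_nonneg_right hr h3
  linarith

theorem hardDensity_support (hw : 0 ≤ w) (ha : 1 / 2 - 1 / 48 ≤ a)
    (haw : a + w ≤ 1 / 2 + 1 / 48) (hr0 : 0 ≤ r) {z : ℝ × ℝ}
    (hz : hardDensity r a w z ≠ 0) : (0 < z.1 ∧ z.1 ≤ 9 / 16) ∧ 7 / 16 < z.2 ∧ z.2 ≤ 1 := by
  have h := abs_sub_hardDensity_le hw ha haw hr0 z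
  by_contra hcon
  rw [not_and_or, not_and_or, not_and_or, not_lt, not_le, not_lt, not_le] at hcon
  refine hz ?_
  rcases hcon with (h1 | h1) | h1 | h1
  · rw [seg_of_le h1, seg_of_le (by linarith : z.1 ≤ 7 / 16),
      seg_of_le (by linarith : z.1 ≤ 3 / 8)] at h
    simpa using h
  · rw [seg_of_lt h1, seg_of_lt (by linarith : 3 / 8 < z.1),
      seg_of_lt (by linarith : 7 / 16 < z.1)] at h
    simpa using h
  · rw [seg_of_le h1, seg_of_le (by linarith : z.2 ≤ 5 / 8),
      seg_of_le (by linarith : z.2 ≤ 9 / 16)] at h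
    simpa using h
  · rw [seg_of_lt h1, seg_of_lt (by linarith : 9 / 16 < z.2),
      seg_of_lt (by linarith : 5 / 8 < z.2)] at h
    simpa using h

end HardDensity

/-! ### The hard laws and the Lagrangian value of a pair of prices -/

section HardLaw

variable {r a w : ℝ}

/-- The law with density `hardDensity r a w`. -/
noncomputable def hardLaw (r a w : ℝ) : Measure (ℝ × ℝ) :=
  volume.withDensity fun z => ENNReal.ofReal (hardDensity r a w z)

/-- `∑ (b - s + c)` over the trades at prices `(p, q)`, per round, for values of law
`hardLaw r a w`. -/
noncomputable def tradeValue (r a w p q c : ℝ) : ℝ :=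
  ∫ z in Set.Iic p ×ˢ Set.Ici q, hardDensity r a w z * (z.2 - z.1 + c)

theorem hasSetIntegral_hardDensity (r a w : ℝ) (A B : Set ℝ) :
    HasSetIntegral (hardDensity r a w) (A ×ˢ B)
      (8 / 3 * ((∫ x in A, seg 0 (3 / 8) x) * ∫ x in B, seg (7 / 16) (9 / 16) x) +
      -(256 / 9) * ((∫ x in A, lowSign x) * ∫ x in B, midLin x) +
      8 / 3 * ((∫ x in A, seg (7 / 16) (9 / 16) x) * ∫ x in B, seg (5 / 8) 1 x) +
      256 / 9 * ((∫ x in A, midLin x) * ∫ x in B, highSign x) +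
      192 * ((∫ x in A, seg (3 / 8) (7 / 16) x) * ∫ x in B, seg (9 / 16) (5 / 8) x) +
      r * ((∫ x in A, lowSign x) * ∫ x in B, cellSign a w x)) := by
  have hs := fun a b => (hasMoments_seg a b).integrable
  have hl := hasMoments_lowSign.integrable
  have hm := hasMoments_midLin.integrable
  exact ((((((hasSetIntegral_prod_mul (hs _ _) (hs _ _) A B).const_mul _).add
    ((hasSetIntegral_prod_mul hl hm A B).const_mul _)).add
    ((hasSetIntegral_prod_mul (hs _ _) (hs _ _) A B).const_mul _)).add
    ((hasSetIntegral_prod_mul hm hasMoments_highSign.integrable A B).const_mul _)).add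
    ((hasSetIntegral_prod_mul (hs _ _) (hs _ _) A B).const_mul _)).add
    ((hasSetIntegral_prod_mul hl (hasMoments_cellSign a w).integrable A B).const_mul _)

theorem integrable_hardDensity (r a w : ℝ) : Integrable (hardDensity r a w) := by
  have := (hasSetIntegral_hardDensity r a w Set.univ Set.univ).1
  rwa [Set.univ_prod_univ, integrableOn_univ] at this

theorem integral_cellSign {w : ℝ} (hw : 0 ≤ w) (a : ℝ) : ∫ x, cellSign a w x = 0 := by
  unfold cellSign
  rw [integral_sub (hasMoments_seg _ _).integrable (hasMoments_seg _ _).integrable,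
    integral_seg (by linarith), integral_seg (by linarith)]
  ring

theorem integral_lowSign : ∫ x, lowSign x = 0 := by
  unfold lowSign
  rw [integral_sub (hasMoments_seg _ _).integrable (hasMoments_seg _ _).integrable,
    integral_seg (by norm_num), integral_seg (by norm_num)]
  norm_num

theorem integral_highSign : ∫ x, highSign x = 0 := by
  unfold highSign
  rw [integral_sub (hasMoments_seg _ _).integrable (hasMoments_seg _ _).integrable,
    integral_seg (by norm_num), integral_seg (by norm_num)]
  norm_num

theorem integral_hardDensity (r a w : ℝ) : ∫ z, hardDensity r a w z = 1 := by
  have h := (hasSetIntegral_hardDensity r a w Set.univ Set.univ).2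
  simp only [Set.univ_prod_univ, setIntegral_univ, integral_lowSign, integral_highSign] at h
  rw [h, integral_seg (by norm_num), integral_seg (by norm_num), integral_seg (by norm_num),
    integral_seg (by norm_num), integral_seg (by norm_num)]
  norm_num

/-- For `r = 0` the cell is irrelevant; `1 / 2` and `0` are placeholders satisfying the constraints
on cells. -/
theorem setIntegral_hardDensity_eq_add (r a w : ℝ) (A B : Set ℝ) :
    ∫ z in A ×ˢ B, hardDensity r a w z = (∫ z in A ×ˢ B, hardDensity 0 (1 / 2) 0 z) +
      r * ((∫ x in A, lowSign x) * ∫ x in B, cellSign a w x) := by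
  rw [(hasSetIntegral_hardDensity r a w A B).2, (hasSetIntegral_hardDensity 0 (1 / 2) 0 A B).2]
  ring

theorem integral_hardLaw (hw : 0 ≤ w) (ha : 1 / 2 - 1 / 48 ≤ a) (haw : a + w ≤ 1 / 2 + 1 / 48)
    (hr0 : 0 ≤ r) (hr : r ≤ 1 / 2) (g : ℝ × ℝ → ℝ) :
    ∫ z, g z ∂(hardLaw r a w) = ∫ z, hardDensity r a w z * g z := by
  rw [hardLaw, integral_withDensity_eq_integral_toReal_smul
    (measurable_hardDensity r a w).ennreal_ofReal (by simp)]
  simp only [ENNReal.toReal_ofReal (hardDensity_nonneg hw ha haw hr0 hr _), smul_eq_mul]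

theorem measureReal_hardLaw (hw : 0 ≤ w) (ha : 1 / 2 - 1 / 48 ≤ a)
    (haw : a + w ≤ 1 / 2 + 1 / 48) (hr0 : 0 ≤ r) (hr : r ≤ 1 / 2) {S : Set (ℝ × ℝ)}
    (hS : MeasurableSet S) : (hardLaw r a w).real S = ∫ z in S, hardDensity r a w z := by
  rw [Measure.real, hardLaw, withDensity_apply _ hS, integral_eq_lintegral_of_nonneg_ae
    (Filter.Eventually.of_forall fun z => hardDensity_nonneg hw ha haw hr0 hr z)
    (measurable_hardDensity r a w).aestronglyMeasurable]

theorem isValueLaw_hardLaw (hw : 0 ≤ w) (ha : 1 / 2 - 1 / 48 ≤ a)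
    (haw : a + w ≤ 1 / 2 + 1 / 48) (hr0 : 0 ≤ r) (hr : r ≤ 1 / 2) :
    IsValueLaw (hardLaw r a w) := by
  refine ⟨⟨?_⟩, ?_⟩
  · rw [hardLaw, withDensity_apply _ MeasurableSet.univ, setLIntegral_univ,
      ← ofReal_integral_eq_lintegral_ofReal (integrable_hardDensity r a w)
        (Filter.Eventually.of_forall fun z => hardDensity_nonneg hw ha haw hr0 hr z),
      integral_hardDensity, ENNReal.ofReal_one]
  · rw [hardLaw, ae_withDensity_iff (measurable_hardDensity r a w).ennreal_ofReal]
    refine Filter.Eventually.of_forall fun z hz => ?_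
    have hz' : hardDensity r a w z ≠ 0 := fun h => hz (by rw [h, ENNReal.ofReal_zero])
    obtain ⟨⟨h1, h2⟩, h3, h4⟩ := hardDensity_support hw ha haw hr0 hz'
    exact ⟨⟨h1.le, by linarith⟩, by linarith, h4⟩

theorem hasDensityBoundedBy_hardLaw (hw : 0 ≤ w) (ha : 1 / 2 - 1 / 48 ≤ a)
    (haw : a + w ≤ 1 / 2 + 1 / 48) (hr0 : 0 ≤ r) (hr : r ≤ 1 / 2) :
    HasDensityBoundedBy 224 (hardLaw r a w) := by
  refine ⟨_, (measurable_hardDensity r a w).ennreal_ofReal, fun z => ?_, rfl⟩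
  have h := ENNReal.ofReal_le_ofReal (hardDensity_le hw ha haw hr0 hr z)
  rw [show (224 : ℝ) = ((224 : ℝ≥0) : ℝ) by norm_num, ENNReal.ofReal_coe_nnreal] at h
  exact h

theorem lagrangian_eq_indicator (l : ℝ) (v x : ℝ × ℝ) : lagrangian l v x =
    (Set.Iic x.1 ×ˢ Set.Ici x.2).indicator (fun v => v.2 - v.1 + l * (x.2 - x.1)) v := by
  unfold lagrangian gft profit trade
  by_cases h : v.1 ≤ x.1 ∧ x.2 ≤ v.2
  · rw [Set.indicator_of_mem (by exact h), if_pos h]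
    ring
  · rw [Set.indicator_of_notMem (by exact h), if_neg h]
    ring

theorem integral_lagrangian_hardLaw (hw : 0 ≤ w) (ha : 1 / 2 - 1 / 48 ≤ a)
    (haw : a + w ≤ 1 / 2 + 1 / 48) (hr0 : 0 ≤ r) (hr : r ≤ 1 / 2) (l : ℝ) (x : ℝ × ℝ) :
    ∫ v, lagrangian l v x ∂(hardLaw r a w) = tradeValue r a w x.1 x.2 (l * (x.2 - x.1)) := by
  rw [integral_hardLaw hw ha haw hr0 hr, tradeValue,
    ← integral_indicator (measurableSet_Iic.prod measurableSet_Ici)]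
  congr 1
  funext z
  rw [lagrangian_eq_indicator, Set.indicator_mul_right]

theorem hasSetIntegral_hardDensity_weight (r a w : ℝ) (A B : Set ℝ) (c : ℝ) :
    HasSetIntegral (fun z => hardDensity r a w z * (z.2 - z.1 + c)) (A ×ˢ B)
      (8 / 3 * ((∫ x in A, seg 0 (3 / 8) x) * (∫ x in B, x * seg (7 / 16) (9 / 16) x) -
          (∫ x in A, x * seg 0 (3 / 8) x) * (∫ x in B, seg (7 / 16) (9 / 16) x) +
          c * ((∫ x in A, seg 0 (3 / 8) x) * ∫ x in B, seg (7 / 16) (9 / 16) x)) +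
      -(256 / 9) * ((∫ x in A, lowSign x) * (∫ x in B, x * midLin x) -
          (∫ x in A, x * lowSign x) * (∫ x in B, midLin x) +
          c * ((∫ x in A, lowSign x) * ∫ x in B, midLin x)) +
      8 / 3 * ((∫ x in A, seg (7 / 16) (9 / 16) x) * (∫ x in B, x * seg (5 / 8) 1 x) -
          (∫ x in A, x * seg (7 / 16) (9 / 16) x) * (∫ x in B, seg (5 / 8) 1 x) +
          c * ((∫ x in A, seg (7 / 16) (9 / 16) x) * ∫ x in B, seg (5 / 8) 1 x)) +
      256 / 9 * ((∫ x in A, midLin x) * (∫ x in B, x * highSign x) -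
          (∫ x in A, x * midLin x) * (∫ x in B, highSign x) +
          c * ((∫ x in A, midLin x) * ∫ x in B, highSign x)) +
      192 * ((∫ x in A, seg (3 / 8) (7 / 16) x) * (∫ x in B, x * seg (9 / 16) (5 / 8) x) -
          (∫ x in A, x * seg (3 / 8) (7 / 16) x) * (∫ x in B, seg (9 / 16) (5 / 8) x) +
          c * ((∫ x in A, seg (3 / 8) (7 / 16) x) * ∫ x in B, seg (9 / 16) (5 / 8) x)) +
      r * ((∫ x in A, lowSign x) * (∫ x in B, x * cellSign a w x) -
          (∫ x in A, x * lowSign x) * (∫ x in B, cellSign a w x) +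
          c * ((∫ x in A, lowSign x) * ∫ x in B, cellSign a w x))) := by
  have hs := fun a b => hasMoments_seg a b
  have hl := hasMoments_lowSign
  have hm := hasMoments_midLin
  have key := ((((((hasSetIntegral_prod_mul_weight (hs 0 (3 / 8)) (hs (7 / 16) (9 / 16))
      A B c).const_mul (8 / 3)).add
    ((hasSetIntegral_prod_mul_weight hl hm A B c).const_mul (-(256 / 9)))).add
    ((hasSetIntegral_prod_mul_weight (hs (7 / 16) (9 / 16)) (hs (5 / 8) 1)
      A B c).const_mul (8 / 3))).add
    ((hasSetIntegral_prod_mul_weight hm hasMoments_highSign A B c).const_mul (256 / 9))).add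
    ((hasSetIntegral_prod_mul_weight (hs (3 / 8) (7 / 16)) (hs (9 / 16) (5 / 8))
      A B c).const_mul 192)).add
    ((hasSetIntegral_prod_mul_weight hl (hasMoments_cellSign a w) A B c).const_mul r)
  convert key using 1
  funext z
  unfold hardDensity
  ring

/-- Why cheap prices are blind: once all low sellers accept, the sign cancels and the perturbation
disappears from the acceptance probabilities. -/
theorem setIntegral_Iic_lowSign {p : ℝ} (hp : 3 / 8 ≤ p) : ∫ x in Set.Iic p, lowSign x = 0 := by
  unfold lowSign
  rw [integral_sub (hasMoments_seg _ _).integrable.integrableOn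
    (hasMoments_seg _ _).integrable.integrableOn, setIntegral_Iic_seg, setIntegral_Iic_seg,
    clamp_of_ge (by norm_num) (by linarith), clamp_of_ge (by norm_num) hp]
  norm_num

/-- The first moment does not cancel, so the perturbation affects gains even where it is invisible.
Its inverse is the coefficient `256/9` in the density, which makes the mean seller value grow at
unit rate with the middle buyer value. -/
theorem setIntegral_Iic_id_mul_lowSign {p : ℝ} (hp : 3 / 8 ≤ p) :
    ∫ x in Set.Iic p, x * lowSign x = -(9 / 256) := by
  simp only [lowSign, mul_sub]
  rw [integral_sub (hasMoments_seg _ _).id_mul.integrable.integrableOn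
    (hasMoments_seg _ _).id_mul.integrable.integrableOn, setIntegral_Iic_id_mul_seg,
    setIntegral_Iic_id_mul_seg, clamp_of_ge (by norm_num) (by linarith),
    clamp_of_ge (by norm_num) hp]
  norm_num

theorem setIntegral_Ici_highSign {q : ℝ} (hq : q ≤ 5 / 8) : ∫ x in Set.Ici q, highSign x = 0 := by
  unfold highSign
  rw [integral_sub (hasMoments_seg _ _).integrable.integrableOn
    (hasMoments_seg _ _).integrable.integrableOn, setIntegral_Ici_seg (by norm_num),
    setIntegral_Ici_seg (by norm_num), clamp_of_le (by linarith), clamp_of_le hq]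
  norm_num

theorem setIntegral_Ici_id_mul_highSign {q : ℝ} (hq : q ≤ 5 / 8) :
    ∫ x in Set.Ici q, x * highSign x = 9 / 256 := by
  simp only [highSign, mul_sub]
  rw [integral_sub (hasMoments_seg _ _).id_mul.integrable.integrableOn
    (hasMoments_seg _ _).id_mul.integrable.integrableOn, setIntegral_Ici_id_mul_seg (by norm_num),
    setIntegral_Ici_id_mul_seg (by norm_num), clamp_of_le (by linarith), clamp_of_le hq]
  norm_num

theorem setIntegral_midLin (A : Set ℝ) : ∫ x in A, midLin x =
    (∫ x in A, x * seg (7 / 16) (9 / 16) x) - 1 / 2 * ∫ x in A, seg (7 / 16) (9 / 16) x := by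
  unfold midLin
  rw [integral_sub (hasMoments_seg _ _).id_mul.integrable.integrableOn
    ((hasMoments_seg _ _).const_mul _).integrable.integrableOn, integral_const_mul]

/-- The corrections turn the weights of the two outer blocks into the constant `5/16 + c`; the
second line is the central block, and the third is the perturbation, through the first moment of
`lowSign`. -/
theorem tradeValue_eq {p q : ℝ} (hp : 3 / 8 ≤ p) (hq : q ≤ 5 / 8) (r a w c : ℝ) :
    tradeValue r a w p q c = (5 / 16 + c) *
      ((clamp (7 / 16) (9 / 16) p - 7 / 16) + (9 / 16 - clamp (7 / 16) (9 / 16) q)) +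
      192 * ((clamp (3 / 8) (7 / 16) p - 3 / 8) *
          (((5 / 8) ^ 2 - clamp (9 / 16) (5 / 8) q ^ 2) / 2) -
        (clamp (3 / 8) (7 / 16) p ^ 2 - (3 / 8) ^ 2) / 2 * (5 / 8 - clamp (9 / 16) (5 / 8) q) +
        c * ((clamp (3 / 8) (7 / 16) p - 3 / 8) * (5 / 8 - clamp (9 / 16) (5 / 8) q))) +
      r * (9 / 256) * ∫ x in Set.Ici q, cellSign a w x := by
  rw [tradeValue, (hasSetIntegral_hardDensity_weight r a w (Set.Iic p) (Set.Ici q) c).2]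
  simp only [setIntegral_midLin, setIntegral_Iic_lowSign hp, setIntegral_Iic_id_mul_lowSign hp,
    setIntegral_Ici_highSign hq, setIntegral_Ici_id_mul_highSign hq, setIntegral_Iic_seg,
    setIntegral_Iic_id_mul_seg]
  rw [setIntegral_Ici_seg (by norm_num), setIntegral_Ici_seg (by norm_num),
    setIntegral_Ici_seg (by norm_num), setIntegral_Ici_id_mul_seg (by norm_num),
    setIntegral_Ici_id_mul_seg (by norm_num), setIntegral_Ici_id_mul_seg (by norm_num),
    clamp_of_ge (x := p) (a := 0) (by norm_num) hp, clamp_of_le (x := q) (b := 1) hq]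
  ring

theorem setIntegral_Ici_cellSign (hw : 0 ≤ w) (a q : ℝ) : ∫ x in Set.Ici q, cellSign a w x =
    (a + w - clamp (a + w / 2) (a + w) q) - (a + w / 2 - clamp a (a + w / 2) q) := by
  unfold cellSign
  rw [integral_sub (hasMoments_seg _ _).integrable.integrableOn
    (hasMoments_seg _ _).integrable.integrableOn, setIntegral_Ici_seg (by linarith),
    setIntegral_Ici_seg (by linarith)]

theorem setIntegral_Ici_cellSign_eq_zero (hw : 0 ≤ w) {a q : ℝ}
    (hq : q ∉ Set.Ioo a (a + w)) : ∫ x in Set.Ici q, cellSign a w x = 0 := by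
  rw [setIntegral_Ici_cellSign hw]
  rcases le_or_gt q a with h | h
  · rw [clamp_of_le (by linarith), clamp_of_le h]
    ring
  · have h' : a + w ≤ q := not_lt.1 fun h' => hq ⟨h, h'⟩
    rw [clamp_of_ge (by linarith) h', clamp_of_ge (by linarith) (by linarith)]
    ring

theorem setIntegral_Ici_cellSign_le (hw : 0 ≤ w) (a q : ℝ) :
    ∫ x in Set.Ici q, cellSign a w x ≤ w / 2 := by
  rw [setIntegral_Ici_cellSign hw]
  have h1 : a + w / 2 ≤ clamp (a + w / 2) (a + w) q := le_max_left _ _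
  have h2 : clamp a (a + w / 2) q ≤ a + w / 2 := max_le (by linarith) (min_le_left _ _)
  linarith

theorem setIntegral_Ici_cellSign_center (hw : 0 ≤ w) (a : ℝ) :
    ∫ x in Set.Ici (a + w / 2), cellSign a w x = w / 2 := by
  rw [setIntegral_Ici_cellSign hw, clamp_of_le le_rfl, clamp_of_ge (by linarith) le_rfl]
  ring

/-- On the support, a trade forces `q - p ≤ 1`, and `b - s ≥ -1/8`; with `l ≥ 1/8` the integrand
with constant `l` is nonnegative, so enlarging the trading region cannot decrease the integral. -/
theorem tradeValue_mono (hw : 0 ≤ w) (ha : 1 / 2 - 1 / 48 ≤ a) (haw : a + w ≤ 1 / 2 + 1 / 48)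
    (hr0 : 0 ≤ r) (hr : r ≤ 1 / 2) {p q p' q' : ℝ} (hp : p ≤ p') (hq : q' ≤ q) {l : ℝ}
    (hl : 1 / 8 ≤ l) : tradeValue r a w p q (l * (q - p)) ≤ tradeValue r a w p' q' l := by
  unfold tradeValue
  rw [← integral_indicator (measurableSet_Iic.prod measurableSet_Ici),
    ← integral_indicator (measurableSet_Iic.prod measurableSet_Ici)]
  refine integral_mono ?_ ?_ fun z => ?_
  · exact (hasSetIntegral_hardDensity_weight r a w _ _ _).1.integrable_indicator
      (measurableSet_Iic.prod measurableSet_Ici)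
  · exact (hasSetIntegral_hardDensity_weight r a w _ _ _).1.integrable_indicator
      (measurableSet_Iic.prod measurableSet_Ici)
  by_cases h0 : hardDensity r a w z = 0
  · simp [Set.indicator_apply, h0]
  obtain ⟨⟨h1, h2⟩, h3, h4⟩ := hardDensity_support hw ha haw hr0 h0
  have hd := hardDensity_nonneg hw ha haw hr0 hr z
  by_cases hz : z ∈ Set.Iic p ×ˢ Set.Ici q
  · have hz' : z ∈ Set.Iic p' ×ˢ Set.Ici q' :=
      ⟨le_trans (show z.1 ≤ p from hz.1) hp, le_trans hq (show q ≤ z.2 from hz.2)⟩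
    rw [Set.indicator_of_mem hz, Set.indicator_of_mem hz']
    have h5 : z.1 ≤ p := hz.1
    have h6 : q ≤ z.2 := hz.2
    have : l * (q - p) ≤ l := mul_le_of_le_one_right (by linarith) (by linarith)
    gcongr
  · rw [Set.indicator_of_notMem hz]
    refine Set.indicator_nonneg (fun _ _ => mul_nonneg hd ?_) z
    linarith

/-- All of the central block and of the middle sellers is lost. What remains has mass 1/8 and, after
the comparison, value `(5/16 + 5/14) / 8`. -/
theorem tradeValue_le_of_le (hw : 0 ≤ w) (ha : 1 / 2 - 1 / 48 ≤ a)
    (haw : a + w ≤ 1 / 2 + 1 / 48) (hr0 : 0 ≤ r) (hr : r ≤ 1 / 2) {p : ℝ} (hp : p ≤ 3 / 8)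
    (q : ℝ) : tradeValue r a w p q (5 / 14 * (q - p)) ≤ 23 / 128 - 1 / 16 := by
  refine (tradeValue_mono hw ha haw hr0 hr hp (min_le_left q (7 / 16)) (by norm_num)).trans ?_
  have h1 : min q (7 / 16) ≤ 7 / 16 := min_le_right _ _
  rw [tradeValue_eq le_rfl (by linarith), clamp_of_le (by norm_num), clamp_of_le h1,
    clamp_of_le le_rfl, clamp_of_le (by linarith), setIntegral_Ici_cellSign_eq_zero hw
    fun h => by linarith [h.1]]
  norm_num

theorem tradeValue_le_of_ge (hw : 0 ≤ w) (ha : 1 / 2 - 1 / 48 ≤ a)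
    (haw : a + w ≤ 1 / 2 + 1 / 48) (hr0 : 0 ≤ r) (hr : r ≤ 1 / 2) (p : ℝ) {q : ℝ}
    (hq : 5 / 8 ≤ q) : tradeValue r a w p q (5 / 14 * (q - p)) ≤ 23 / 128 - 1 / 16 := by
  refine (tradeValue_mono hw ha haw hr0 hr (le_max_left p (9 / 16)) hq (by norm_num)).trans ?_
  have h1 : 9 / 16 ≤ max p (9 / 16) := le_max_right _ _
  rw [tradeValue_eq (by linarith) le_rfl, clamp_of_ge (by norm_num) h1,
    clamp_of_ge (by norm_num) (by norm_num), clamp_of_ge (by norm_num) (by linarith),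
    clamp_of_ge (by norm_num) le_rfl, setIntegral_Ici_cellSign_eq_zero hw
    fun h => by linarith [h.2]]
  norm_num

/-- For both prices in the middle interval and `d = q - p`, the coefficient of `d` with multiplier
`l` is `-5/16 + l/8 + 3l/4`; it vanishes exactly for `l = 5/14`, leaving `23/128 - l d^2`. The other
three cases, with prices inside the range of the central block, are polynomial inequalities. -/
theorem tradeValue_le_base {p q : ℝ} (hp : 3 / 8 ≤ p) (hq : q ≤ 5 / 8) (hp' : p ≤ 9 / 16)
    (hq' : 7 / 16 ≤ q) :
    tradeValue 0 a w p q (5 / 14 * (q - p)) ≤ 23 / 128 := by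
  rw [tradeValue_eq hp hq]
  rcases le_total p (7 / 16) with h1 | h1 <;> rcases le_total q (9 / 16) with h2 | h2
  · rw [clamp_of_le h1, clamp_of_mem hq' h2, clamp_of_mem hp h1, clamp_of_le h2]
    nlinarith [mul_nonneg (sub_nonneg.2 h1) (sub_nonneg.2 hp),
      mul_nonneg (sub_nonneg.2 h1) (sub_nonneg.2 hq'),
      mul_nonneg (sub_nonneg.2 h1) (sub_nonneg.2 h2),
      mul_nonneg (sub_nonneg.2 hq') (sub_nonneg.2 h2), sq_nonneg (q - 7 / 16),
      mul_nonneg (mul_nonneg (sub_nonneg.2 h1) (sub_nonneg.2 hp)) (sub_nonneg.2 hq')]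
  · rw [clamp_of_le h1, clamp_of_ge (by norm_num) h2, clamp_of_mem hp h1, clamp_of_mem h2 hq]
    nlinarith [mul_nonneg (sub_nonneg.2 h1) (sub_nonneg.2 hp),
      mul_nonneg (sub_nonneg.2 h2) (sub_nonneg.2 hq),
      mul_nonneg (sub_nonneg.2 h1) (sub_nonneg.2 hq),
      mul_nonneg (sub_nonneg.2 h1) (sub_nonneg.2 h2),
      mul_nonneg (sub_nonneg.2 hp) (sub_nonneg.2 hq),
      mul_nonneg (sub_nonneg.2 hp) (sub_nonneg.2 h2),
      mul_nonneg (mul_nonneg (sub_nonneg.2 h1) (sub_nonneg.2 hp)) (sub_nonneg.2 hq),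
      mul_nonneg (mul_nonneg (sub_nonneg.2 h2) (sub_nonneg.2 hp)) (sub_nonneg.2 hq)]
  · rw [clamp_of_mem h1 hp', clamp_of_mem hq' h2, clamp_of_ge (by norm_num) h1, clamp_of_le h2]
    nlinarith [sq_nonneg (p - q)]
  · rw [clamp_of_mem h1 hp', clamp_of_ge (by norm_num) h2, clamp_of_ge (by norm_num) h1,
      clamp_of_mem h2 hq]
    nlinarith [mul_nonneg (sub_nonneg.2 h2) (sub_nonneg.2 hq),
      mul_nonneg (sub_nonneg.2 h2) (sub_nonneg.2 h1),
      mul_nonneg (sub_nonneg.2 h2) (sub_nonneg.2 hp'),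
      mul_nonneg (sub_nonneg.2 h1) (sub_nonneg.2 hp'), sq_nonneg (9 / 16 - p),
      mul_nonneg (mul_nonneg (sub_nonneg.2 h2) (sub_nonneg.2 hq)) (sub_nonneg.2 hp')]

/-- A `p` above `9/16` or a `q` below `7/16` attracts no further trades and only reduces profit, so
the prices may be truncated. -/
theorem tradeValue_zero_le (p q : ℝ) : tradeValue 0 a w p q (5 / 14 * (q - p)) ≤ 23 / 128 := by
  have hz : ∀ p q c, tradeValue 0 a w p q c = tradeValue 0 (1 / 2) 0 p q c := fun p q c => by
    simp only [tradeValue, hardDensity, zero_mul]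
  rcases le_total p (3 / 8) with hp | hp
  · rw [hz]
    exact (tradeValue_le_of_le le_rfl (by norm_num) (by norm_num) le_rfl (by norm_num) hp q).trans
      (by norm_num)
  rcases le_total (5 / 8) q with hq | hq
  · rw [hz]
    exact (tradeValue_le_of_ge le_rfl (by norm_num) (by norm_num) le_rfl (by norm_num) p hq).trans
      (by norm_num)
  have hcl : ∀ {α β x : ℝ}, β ≤ 9 / 16 → clamp α β (min x (9 / 16)) = clamp α β x := by
    intro α β x h
    rw [clamp, clamp, min_left_comm, min_eq_left h, min_comm]
  have hcl' : ∀ {α β x : ℝ}, 7 / 16 ≤ α → clamp α β (max x (7 / 16)) = clamp α β x := by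
    intro α β x h
    unfold clamp
    grind
  have hb := tradeValue_le_base (a := a) (w := w) (p := min p (9 / 16)) (q := max q (7 / 16))
    (le_min hp (by norm_num)) (max_le hq (by norm_num)) (min_le_right _ _) (le_max_right _ _)
  refine le_trans ?_ hb
  rw [tradeValue_eq hp hq, tradeValue_eq (le_min hp (by norm_num)) (max_le hq (by norm_num)),
    hcl le_rfl, hcl' le_rfl, hcl (by norm_num), hcl' (by norm_num),
    zero_mul, zero_mul]
  have hc : 5 / 14 * (q - p) ≤ 5 / 14 * (max q (7 / 16) - min p (9 / 16)) := by
    linarith [le_max_left q (7 / 16), min_le_left p (9 / 16)]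
  have e1 : 7 / 16 ≤ clamp (7 / 16) (9 / 16) p := le_max_left _ _
  have e2 : clamp (7 / 16) (9 / 16) q ≤ 9 / 16 := max_le (by norm_num) (min_le_left _ _)
  have e3 : 3 / 8 ≤ clamp (3 / 8) (7 / 16) p := le_max_left _ _
  have e4 : clamp (9 / 16) (5 / 8) q ≤ 5 / 8 := max_le (by norm_num) (min_le_left _ _)
  have f1 := mul_le_mul_of_nonneg_right hc (by linarith :
    0 ≤ (clamp (7 / 16) (9 / 16) p - 7 / 16) + (9 / 16 - clamp (7 / 16) (9 / 16) q))
  have f2 := mul_le_mul_of_nonneg_right hc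
    (mul_nonneg (sub_nonneg.2 e3) (sub_nonneg.2 e4))
  linarith

end HardLaw

/-! ### What the two bits reveal about the cell, and what the cell is worth -/

section Feedback

variable {r a w : ℝ}

theorem twoBit_eq_preimage (x : ℝ × ℝ) (o : Bool × Bool) : {v | twoBit v x = o} =
    (if o.1 then Set.Iic x.1 else Set.Ioi x.1) ×ˢ (if o.2 then Set.Ici x.2 else Set.Iio x.2) := by
  obtain ⟨o₁, o₂⟩ := o
  ext v
  cases o₁ <;> cases o₂ <;> simp [twoBit]

theorem feedbackLaw_hardLaw (hw : 0 ≤ w) (ha : 1 / 2 - 1 / 48 ≤ a)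
    (haw : a + w ≤ 1 / 2 + 1 / 48) (hr0 : 0 ≤ r) (hr : r ≤ 1 / 2) (x : ℝ × ℝ) (o : Bool × Bool) :
    feedbackLaw (hardLaw r a w) x o =
      ∫ z in (if o.1 then Set.Iic x.1 else Set.Ioi x.1) ×ˢ
        (if o.2 then Set.Ici x.2 else Set.Iio x.2), hardDensity r a w z := by
  rw [feedbackLaw, measureReal_hardLaw hw ha haw hr0 hr (measurableSet_twoBit_eq x o),
    twoBit_eq_preimage]

theorem abs_setIntegral_lowSign_le (A : Set ℝ) :
    |∫ x in A, lowSign x| ≤ ∫ x in A, seg 0 (3 / 8) x :=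
  norm_integral_le_of_norm_le (μ := volume.restrict A) (f := lowSign)
    (hasMoments_seg _ _).integrable.integrableOn (Filter.Eventually.of_forall abs_lowSign_le)

theorem abs_setIntegral_cellSign_le (hw : 0 ≤ w) (a : ℝ) (B : Set ℝ) :
    |∫ x in B, cellSign a w x| ≤ w := by
  refine (norm_integral_le_of_norm_le (μ := volume.restrict B) (f := cellSign a w)
    (hasMoments_seg a (a + w)).integrable.integrableOn
    (Filter.Eventually.of_forall fun x => abs_cellSign_le hw x)).trans ?_
  refine (setIntegral_le_integral (hasMoments_seg _ _).integrable
    (Filter.Eventually.of_forall fun x => seg_nonneg _ _ x)).trans ?_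
  rw [integral_seg (by linarith)]
  linarith

theorem low_mul_mid_le_setIntegral (A B : Set ℝ) :
    8 / 9 * ((∫ x in A, seg 0 (3 / 8) x) * ∫ x in B, seg (7 / 16) (9 / 16) x) ≤
      ∫ z in A ×ˢ B, hardDensity 0 (1 / 2) 0 z := by
  have h := (hasSetIntegral_prod_mul (hasMoments_seg 0 (3 / 8)).integrable
    (hasMoments_seg (7 / 16) (9 / 16)).integrable A B).const_mul (8 / 9)
  rw [← h.2]
  refine integral_mono h.1 (integrable_hardDensity _ _ _).integrableOn fun z => ?_
  simpa using low_mul_mid_le_hardDensity (r := 0) (a := 1 / 2) (w := 0) le_rfl (by norm_num)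
    (by norm_num) le_rfl z

/-- Cells lie within 1/48 of 1/2, so either answer of the buyer keeps middle buyers of length at
least `1/16 - 1/48`. -/
theorem le_setIntegral_mid (ha : 1 / 2 - 1 / 48 ≤ a)
    (haw : a + w ≤ 1 / 2 + 1 / 48) {q : ℝ} (hq : q ∈ Set.Ioo a (a + w)) (b : Bool) :
    1 / 24 ≤ ∫ x in (if b then Set.Ici q else Set.Iio q), seg (7 / 16) (9 / 16) x := by
  obtain ⟨h1, h2⟩ := hq
  cases b
  · simp only [Bool.false_eq_true, if_false]
    rw [setIntegral_Iio_eq (hasMoments_seg _ _).integrable, integral_seg (by norm_num),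
      setIntegral_Ici_seg (by norm_num), clamp_of_mem (by linarith) (by linarith)]
    linarith
  · simp only [if_true]
    rw [setIntegral_Ici_seg (by norm_num), clamp_of_mem (by linarith) (by linarith)]
    linarith

/-- Both the change and the base probability carry the factor `∫ seg 0 (3/8)` over the seller's
side, so the ratio survives when few low sellers accept. The rest is `r * w` against `8/9 * 1/24 =
1/27`. -/
theorem abs_feedbackLaw_sub_le (hw : 0 ≤ w) (ha : 1 / 2 - 1 / 48 ≤ a)
    (haw : a + w ≤ 1 / 2 + 1 / 48) (hr0 : 0 ≤ r) (hr : r ≤ 1 / 2) (x : ℝ × ℝ) (o : Bool × Bool) :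
    |feedbackLaw (hardLaw r a w) x o - feedbackLaw (hardLaw 0 (1 / 2) 0) x o| ≤
      ({x : ℝ × ℝ | x.2 ∈ Set.Ioo a (a + w)} ∩ {x | x.1 < 3 / 8}).indicator
        (fun _ => 27 * r * w) x * feedbackLaw (hardLaw 0 (1 / 2) 0) x o := by
  rw [feedbackLaw_hardLaw hw ha haw hr0 hr, feedbackLaw_hardLaw le_rfl (by norm_num)
    (by norm_num) le_rfl (by norm_num), setIntegral_hardDensity_eq_add r a w, add_sub_cancel_left]
  set A : Set ℝ := if o.1 then Set.Iic x.1 else Set.Ioi x.1 with hA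
  set B : Set ℝ := if o.2 then Set.Ici x.2 else Set.Iio x.2 with hB
  by_cases hx : x ∈ {x : ℝ × ℝ | x.2 ∈ Set.Ioo a (a + w)} ∩ {x | x.1 < 3 / 8}
  · rw [Set.indicator_of_mem hx]
    have hmid := le_setIntegral_mid ha haw hx.1 o.2
    rw [← hB] at hmid
    have h1 := abs_setIntegral_lowSign_le A
    have h2 := abs_setIntegral_cellSign_le hw a B
    have h3 := low_mul_mid_le_setIntegral A B
    rw [abs_mul, abs_mul, abs_of_nonneg hr0]
    set lA := ∫ x in A, seg 0 (3 / 8) x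
    have h0 : 0 ≤ lA := (abs_nonneg _).trans h1
    calc r * (|∫ x in A, lowSign x| * |∫ x in B, cellSign a w x|) ≤ r * (lA * w) := by gcongr
      _ = 27 * r * w * (8 / 9 * (lA * (1 / 24))) := by ring
      _ ≤ 27 * r * w * (8 / 9 * (lA * ∫ x in B, seg (7 / 16) (9 / 16) x)) := by gcongr
      _ ≤ _ := by gcongr
  · rw [Set.indicator_of_notMem hx, zero_mul]
    have hzero : (∫ x in A, lowSign x) * ∫ x in B, cellSign a w x = 0 := by
      rcases not_and_or.1 hx with h | h
      · have h' := setIntegral_Ici_cellSign_eq_zero hw h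
        refine mul_eq_zero_of_right _ ?_
        rw [hB]
        split_ifs
        · exact h'
        · rw [setIntegral_Iio_eq (hasMoments_cellSign a w).integrable, h', integral_cellSign hw,
            sub_zero]
      · have h' := setIntegral_Iic_lowSign (not_lt.1 h)
        refine mul_eq_zero_of_left ?_ _
        rw [hA]
        split_ifs
        · exact h'
        · rw [setIntegral_Ioi_eq hasMoments_lowSign.integrable, h', integral_lowSign, sub_zero]
    simp [hzero]

theorem feedbackLaw_nonneg (D : Measure (ℝ × ℝ)) (x : ℝ × ℝ) (o : Bool × Bool) :
    0 ≤ feedbackLaw D x o := measureReal_nonneg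

/-- As a function of `q`, the integral of `cellSign` is a tent supported on the cell, of height `w /
2`. -/
theorem tradeValue_le (hw : 0 ≤ w) (ha : 1 / 2 - 1 / 48 ≤ a)
    (haw : a + w ≤ 1 / 2 + 1 / 48) (hr0 : 0 ≤ r) (hr : r ≤ 1 / 2) (p q : ℝ) :
    tradeValue r a w p q (5 / 14 * (q - p)) ≤
      23 / 128 + 9 / 512 * r * w * (Set.Ioo a (a + w)).indicator 1 q := by
  have h0 : 0 ≤ 9 / 512 * r * w * (Set.Ioo a (a + w)).indicator 1 q :=
    mul_nonneg (by positivity) (Set.indicator_nonneg (fun _ _ => zero_le_one) q)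
  rcases le_total p (3 / 8) with hp | hp
  · linarith [tradeValue_le_of_le hw ha haw hr0 hr hp q]
  rcases le_total (5 / 8) q with hq | hq
  · linarith [tradeValue_le_of_ge hw ha haw hr0 hr p hq]
  have hb := tradeValue_zero_le (a := a) (w := w) p q
  rw [tradeValue_eq hp hq] at hb ⊢
  by_cases hqc : q ∈ Set.Ioo a (a + w)
  · rw [Set.indicator_of_mem hqc, Pi.one_apply, mul_one]
    have := mul_le_mul_of_nonneg_left (setIntegral_Ici_cellSign_le hw a q)
      (by positivity : 0 ≤ r * (9 / 256))
    linarith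
  · rw [setIntegral_Ici_cellSign_eq_zero hw hqc] at hb ⊢
    linarith

theorem tradeValue_center (hw : 0 ≤ w) (ha : 1 / 2 - 1 / 48 ≤ a)
    (haw : a + w ≤ 1 / 2 + 1 / 48) (r : ℝ) :
    tradeValue r a w (a + w / 2) (a + w / 2) 0 = 23 / 128 + 9 / 512 * r * w := by
  rw [tradeValue_eq (by linarith) (by linarith), clamp_of_mem (by linarith) (by linarith),
    clamp_of_ge (by norm_num) (by linarith), clamp_of_le (by linarith),
    setIntegral_Ici_cellSign_center hw]
  ring

end Feedback

/-! ### Averaging over the cells and choosing their number -/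

section Regret

variable {T : ℕ}

/-- Left endpoint of the cell `i` of the partition of `[1/2 - 1/48, 1/2 + 1/48]` into `K` cells. -/
noncomputable def cellLeft (K : ℕ) (i : Fin K) : ℝ := 1 / 2 - 1 / 48 + i * (1 / (24 * K))

theorem cellLeft_ge (K : ℕ) (i : Fin K) : 1 / 2 - 1 / 48 ≤ cellLeft K i :=
  le_add_of_nonneg_right (by positivity)

theorem cellLeft_add_le (K : ℕ) (i : Fin K) :
    cellLeft K i + 1 / (24 * K) ≤ 1 / 2 + 1 / 48 := by
  have hi : ((i : ℕ) : ℝ) + 1 ≤ K := by exact_mod_cast i.isLt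
  have hK : (0 : ℝ) < K := lt_of_lt_of_le (by positivity) hi
  have : ((i : ℕ) + 1) * (1 / (24 * (K : ℝ))) ≤ K * (1 / (24 * (K : ℝ))) := by gcongr
  have h2 : (K : ℝ) * (1 / (24 * (K : ℝ))) = 1 / 24 := by field_simp
  unfold cellLeft
  linarith

theorem pairwise_disjoint_cells (K : ℕ) : Pairwise fun i j : Fin K =>
    Disjoint {x : ℝ × ℝ | x.2 ∈ Set.Ioo (cellLeft K i) (cellLeft K i + 1 / (24 * K))}
      {x | x.2 ∈ Set.Ioo (cellLeft K j) (cellLeft K j + 1 / (24 * K))} := by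
  have key : ∀ i j : Fin K, i < j → cellLeft K i + 1 / (24 * K) ≤ cellLeft K j := by
    intro i j hij
    have h : ((i : ℕ) : ℝ) + 1 ≤ (j : ℕ) := by exact_mod_cast hij
    have : ((i : ℕ) + 1) * (1 / (24 * (K : ℝ))) ≤ (j : ℕ) * (1 / (24 * (K : ℝ))) := by gcongr
    unfold cellLeft
    linarith
  intro i j hij
  refine Set.disjoint_left.2 fun x hx hy => ?_
  rcases lt_or_gt_of_ne hij with h | h
  · linarith [key i j h, hx.2, hy.1]
  · linarith [key j i h, hx.1, hy.2]

/-- Comparison, for every pricing strategy, of its performance on the hard instances. -/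
theorem sum_totalValue_hardLaw_le {K : ℕ} (hK : 2 ≤ K)
    (σ : (n : ℕ) → (Fin n → Bool × Bool) → ℝ × ℝ) (T : ℕ) {w θ : ℝ} (hw : w = 1 / (24 * K))
    (hθ : θ = 16 * T * (27 / 2 * w) ^ 2 * (9 / 1024 * w) / (1 / 16)) :
    ∑ i : Fin K, totalValue (feedbackLaw (hardLaw (1 / 2) (cellLeft K i) w))
        (fun x => ∫ v, lagrangian (5 / 14) v x ∂(hardLaw (1 / 2) (cellLeft K i) w)) σ T +
      θ * totalValue (feedbackLaw (hardLaw 0 (1 / 2) 0))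
        (fun x => ∫ v, lagrangian (5 / 14) v x ∂(hardLaw 0 (1 / 2) 0)) σ T ≤
      (K + θ) * (T * (23 / 128)) + 9 / 1024 * w * T * (1 + K / 8) := by
  have hw0 : 0 ≤ w := by rw [hw]; positivity
  have ha : ∀ i : Fin K, 1 / 2 - 1 / 48 ≤ cellLeft K i := cellLeft_ge K
  have haw : ∀ i : Fin K, cellLeft K i + w ≤ 1 / 2 + 1 / 48 := by
    rw [hw]; exact cellLeft_add_le K
  -- With at least two cells, `27/2 * w ≤ 1/2`, as the entropy bound requires.
  have hw48 : w ≤ 1 / 48 := by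
    have : (2 : ℝ) ≤ K := by exact_mod_cast hK
    rw [hw]
    exact one_div_le_one_div_of_le (by norm_num) (by linarith)
  have hV : ∀ i : Fin K, IsValueLaw (hardLaw (1 / 2) (cellLeft K i) w) := fun i =>
    isValueLaw_hardLaw hw0 (ha i) (haw i) (by norm_num) le_rfl
  have hV0 : IsValueLaw (hardLaw 0 (1 / 2) 0) :=
    isValueLaw_hardLaw le_rfl (by norm_num) (by norm_num) le_rfl (by norm_num)
  have hdisj := pairwise_disjoint_cells K
  rw [← hw] at hdisj
  have := sum_totalValue_le (G := 23 / 128) (ε := 9 / 1024 * w) (c := 1 / 16) (δ := 27 / 2 * w)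
    (k₀ := feedbackLaw (hardLaw 0 (1 / 2) 0))
    (k := fun i : Fin K => feedbackLaw (hardLaw (1 / 2) (cellLeft K i) w))
    (L₀ := fun x => ∫ v, lagrangian (5 / 14) v x ∂(hardLaw 0 (1 / 2) 0))
    (L := fun i x => ∫ v, lagrangian (5 / 14) v x ∂(hardLaw (1 / 2) (cellLeft K i) w))
    (hot := fun i => {x | x.2 ∈ Set.Ioo (cellLeft K i) (cellLeft K i + w)})
    (costly := {x | x.1 < 3 / 8})
    (feedbackLaw_nonneg _) (fun i => feedbackLaw_nonneg _)
    (fun x => have := hV0.1; sum_feedbackLaw _ x) (fun i x => have := (hV i).1; sum_feedbackLaw _ x)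
    (by positivity) (by norm_num) (by linarith) hdisj
    (fun i x o => by
      have := abs_feedbackLaw_sub_le hw0 (ha i) (haw i) (by norm_num) le_rfl x o
      rwa [show 27 * (1 / 2) * w = 27 / 2 * w by ring] at this)
    (fun x => by
      rw [integral_lagrangian_hardLaw le_rfl (by norm_num) (by norm_num) le_rfl (by norm_num)]
      by_cases hx : x.1 < 3 / 8
      · rw [Set.indicator_of_mem (by exact hx), Pi.one_apply, mul_one]
        exact tradeValue_le_of_le le_rfl (by norm_num) (by norm_num) le_rfl (by norm_num) hx.le _
      · rw [Set.indicator_of_notMem (by exact hx), mul_zero, sub_zero]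
        exact tradeValue_zero_le _ _)
    (fun i x => by
      rw [integral_lagrangian_hardLaw hw0 (ha i) (haw i) (by norm_num) le_rfl]
      have := tradeValue_le hw0 (ha i) (haw i) (by norm_num) le_rfl x.1 x.2
      rw [show 9 / 512 * (1 / 2) * w = 9 / 1024 * w by ring] at this
      exact this)
    σ T
  rw [Fintype.card_fin, ← hθ] at this
  exact this

theorem lagrangian_zero (v x : ℝ × ℝ) : lagrangian 0 v x = gft v x := by simp [lagrangian]

theorem le_optimalGFT_hardLaw {r a w : ℝ} (hw : 0 ≤ w) (ha : 1 / 2 - 1 / 48 ≤ a)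
    (haw : a + w ≤ 1 / 2 + 1 / 48) (hr0 : 0 ≤ r) (hr : r ≤ 1 / 2) (T : ℕ) :
    T * (23 / 128 + 9 / 512 * r * w) ≤ optimalGFT (Measure.pi fun _ : Fin T => hardLaw r a w) := by
  have h := mul_integral_gft_le_optimalGFT (isValueLaw_hardLaw hw ha haw hr0 hr) T
    (x := (a + w / 2, a + w / 2)) (by simp only []; linarith) le_rfl (by simp only []; linarith)
  simp_rw [← lagrangian_zero] at h
  rwa [integral_lagrangian_hardLaw hw ha haw hr0 hr, zero_mul, tradeValue_center hw ha haw] at h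

theorem Mechanism.le_worstCaseRegret (A : Mechanism.{u} T)
    {𝒟 : Set (Measure (Fin T → ℝ × ℝ))} (h𝒟 : densityBoundedCorrelatedValues T 224 ⊆ 𝒟)
    (h𝒟' : 𝒟 ⊆ adversarialValues T) (hA : A.IsGBB 𝒟) {K : ℕ} (hK : 2 ≤ K) (hTK : T ≤ K ^ 4) :
    9 / 131072 * (T / K : ℝ) ≤ A.worstCaseRegret 𝒟 := by
  obtain ⟨w, hw⟩ : ∃ w : ℝ, w = 1 / (24 * K) := ⟨_, rfl⟩
  obtain ⟨θ, hθ⟩ : ∃ θ : ℝ, θ = 16 * T * (27 / 2 * w) ^ 2 * (9 / 1024 * w) / (1 / 16) := ⟨_, rfl⟩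
  have hK2 : (2 : ℝ) ≤ K := by exact_mod_cast hK
  have hw0 : 0 ≤ w := by rw [hw]; positivity
  have hmem : ∀ {r a v : ℝ}, 0 ≤ v → 1 / 2 - 1 / 48 ≤ a → a + v ≤ 1 / 2 + 1 / 48 → 0 ≤ r →
      r ≤ 1 / 2 → (Measure.pi fun _ : Fin T => hardLaw r a v) ∈ 𝒟 := fun h1 h2 h3 h4 h5 =>
    h𝒟 ⟨_, isValueLaw_hardLaw h1 h2 h3 h4 h5, hasDensityBoundedBy_hardLaw h1 h2 h3 h4 h5, rfl⟩
  set R := A.worstCaseRegret 𝒟 with hR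
  let W : ℝ → ℝ → ℝ → A.Seed → ℝ := fun r a v ω => totalValue (feedbackLaw (hardLaw r a v))
    (fun x => ∫ y, lagrangian (5 / 14) y x ∂(hardLaw r a v)) (A.strategy ω) T
  have hW : ∀ {r a v : ℝ}, 0 ≤ v → 1 / 2 - 1 / 48 ≤ a → a + v ≤ 1 / 2 + 1 / 48 → 0 ≤ r →
      r ≤ 1 / 2 → Integrable (W r a v) A.seedLaw ∧
        T * (23 / 128 + 9 / 512 * r * v) - R ≤ ∫ ω, W r a v ω ∂A.seedLaw := by
    intro r a v h1 h2 h3 h4 h5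
    have hm := hmem h1 h2 h3 h4 h5
    have h6 := A.totalGFT_le_integral_totalValue (isValueLaw_hardLaw h1 h2 h3 h4 h5)
      (by norm_num : (0 : ℝ) ≤ 5 / 14) (hA _ hm)
    have h7 := A.regret_le_worstCaseRegret h𝒟' hm
    have h8 := le_optimalGFT_hardLaw h1 h2 h3 h4 h5 T
    refine ⟨h6.1, le_trans ?_ h6.2⟩
    rw [regret, ← hR] at h7
    linarith
  have hWi : ∀ i : Fin K, _ := fun i => hW (r := 1 / 2) hw0 (cellLeft_ge K i)
    (by rw [hw]; exact cellLeft_add_le K i) (by norm_num) le_rfl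
  have hW0 := hW (r := 0) (a := 1 / 2) (v := 0) le_rfl (by norm_num) (by norm_num) le_rfl
    (by norm_num)
  have hsum : ∑ i : Fin K, ∫ ω, W (1 / 2) (cellLeft K i) w ω ∂A.seedLaw +
      θ * ∫ ω, W 0 (1 / 2) 0 ω ∂A.seedLaw ≤
      (K + θ) * (T * (23 / 128)) + 9 / 1024 * w * T * (1 + K / 8) := by
    rw [← integral_finsetSum _ fun i _ => (hWi i).1, ← integral_const_mul,
      ← integral_add (integrable_finsetSum _ fun i _ => (hWi i).1) (hW0.1.const_mul θ)]
    refine (integral_mono ((integrable_finsetSum _ fun i _ => (hWi i).1).add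
      (hW0.1.const_mul θ)) (integrable_const _) fun ω =>
        sum_totalValue_hardLaw_le hK (A.strategy ω) T hw hθ).trans (le_of_eq ?_)
    simp
  have hlow : (K : ℝ) * (T * (23 / 128 + 9 / 512 * (1 / 2) * w) - R) ≤
      ∑ i : Fin K, ∫ ω, W (1 / 2) (cellLeft K i) w ω ∂A.seedLaw := by
    have := Finset.sum_le_sum fun (i : Fin K) (_ : i ∈ Finset.univ) => (hWi i).2
    simpa only [Finset.sum_const, Finset.card_univ, Fintype.card_fin, nsmul_eq_mul] using this
  have hθ0 : 0 ≤ θ := by rw [hθ]; positivity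
  -- Here the condition `T ≤ K ^ 4` enters: `θ` is a constant multiple of `T * w ^ 3`, so with it
  -- the costly exploration does not pay for itself.
  have hθK : θ ≤ K := by
    have hT : (T : ℝ) ≤ K ^ 4 := by exact_mod_cast hTK
    have hKw : (K : ℝ) * w = 1 / 24 := by rw [hw]; field_simp
    have h3 : (K : ℝ) ^ 4 * w ^ 3 = K * (1 / 24) ^ 3 := by rw [← hKw]; ring
    have h4 : (T : ℝ) * w ^ 3 ≤ K * (1 / 24) ^ 3 := by
      rw [← h3]
      gcongr
    rw [hθ]
    linarith
  have h0 := mul_le_mul_of_nonneg_left hW0.2 hθ0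
  have hKT : (K : ℝ) * T * w = T / 24 := by rw [hw]; field_simp
  have hTw : 2 * ((T : ℝ) * w) ≤ T / 24 := by
    rw [← hKT]
    have := mul_le_mul_of_nonneg_right hK2 (by positivity : 0 ≤ (T : ℝ) * w)
    linarith
  -- The terms in 23/128 cancel and leave `9/1024 * w * T * (K - 1 - K/8)`; since `K ≥ 2`, the last
  -- factor is at least `3K/8`, and `K * w = 1/24`.
  have hmain : 9 / 65536 * (T : ℝ) ≤ (K + θ) * R := by
    linarith
  have hKpos : (0 : ℝ) < K := by linarith
  -- The sign is needed to replace `K + θ` by `2 * K`.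
  have hRpos : 0 ≤ R := by
    by_contra hneg
    have h1 : (K + θ) * R < 0 := mul_neg_of_pos_of_neg (by linarith) (not_le.1 hneg)
    have h2 : (0 : ℝ) ≤ 9 / 65536 * (T : ℝ) := by positivity
    linarith
  have h2K : (K + θ) * R ≤ 2 * K * R := mul_le_mul_of_nonneg_right (by linarith) hRpos
  rw [← mul_div_assoc, div_le_iff₀ hKpos]
  linarith

theorem Mechanism.rpow_le_worstCaseRegret (A : Mechanism.{u} T)
    {𝒟 : Set (Measure (Fin T → ℝ × ℝ))} (h𝒟 : densityBoundedCorrelatedValues T 224 ⊆ 𝒟)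
    (h𝒟' : 𝒟 ⊆ adversarialValues T) (hA : A.IsGBB 𝒟) (hT : 2 ≤ T) :
    9 / 262144 * (T : ℝ) ^ (3 / 4 : ℝ) ≤ A.worstCaseRegret 𝒟 := by
  have hT1 : (1 : ℝ) < T := by exact_mod_cast hT
  have hT0 : (0 : ℝ) < T := by linarith
  set s : ℝ := (T : ℝ) ^ (1 / 4 : ℝ) with hs
  have hs1 : 1 < s := Real.one_lt_rpow hT1 (by norm_num)
  have hs4 : s ^ 4 = T := by
    rw [hs, ← Real.rpow_natCast, ← Real.rpow_mul hT0.le]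
    norm_num
  have hs3 : (T : ℝ) ^ (3 / 4 : ℝ) = s ^ 3 := by
    rw [hs, ← Real.rpow_natCast, ← Real.rpow_mul hT0.le]
    norm_num
  -- The number of cells is `T^(1/4)` rounded up; `T ≥ 2` makes `s > 1`, hence at least two cells.
  have hK : 2 ≤ ⌈s⌉₊ := by
    rw [Nat.succ_le_iff, Nat.lt_ceil]
    exact_mod_cast hs1
  have hTK : T ≤ ⌈s⌉₊ ^ 4 := by
    have : s ^ 4 ≤ (⌈s⌉₊ : ℝ) ^ 4 := pow_le_pow_left₀ (by linarith) (Nat.le_ceil s) 4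
    rw [hs4] at this
    exact_mod_cast this
  have hK2 : (⌈s⌉₊ : ℝ) ≤ 2 * s := by
    have := Nat.ceil_lt_add_one (by linarith : 0 ≤ s)
    linarith
  refine le_trans ?_ (A.le_worstCaseRegret h𝒟 h𝒟' hA hK hTK)
  rw [hs3]
  have hKpos : (0 : ℝ) < ⌈s⌉₊ := by
    have : (2 : ℝ) ≤ ⌈s⌉₊ := by exact_mod_cast hK
    linarith
  rw [← mul_div_assoc, le_div_iff₀ hKpos, ← hs4]
  nlinarith [mul_le_mul_of_nonneg_left hK2 (by positivity : 0 ≤ s ^ 3)]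

end Regret

end BilateralTrade

theorem theorem5p1 :
    ∃ c : ℝ, 0 < c ∧ ∃ T₀ : ℕ, ∀ T : ℕ, T₀ ≤ T → ∀ A : BilateralTrade.Mechanism.{u} T,
      (A.IsGBB (BilateralTrade.correlatedValues T) →
        c * (T : ℝ) ^ (3 / 4 : ℝ) ≤ A.worstCaseRegret (BilateralTrade.correlatedValues T)) ∧
      (A.IsGBB (BilateralTrade.densityBoundedCorrelatedValues T 224) →
        c * (T : ℝ) ^ (3 / 4 : ℝ) ≤
          A.worstCaseRegret (BilateralTrade.densityBoundedCorrelatedValues T 224)) ∧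
      (A.IsGBB (BilateralTrade.adversarialValues T) →
        c * (T : ℝ) ^ (3 / 4 : ℝ) ≤ A.worstCaseRegret (BilateralTrade.adversarialValues T)) := by
  refine ⟨9 / 262144, by norm_num, 2, fun T hT A => ⟨fun hA => ?_, fun hA => ?_, fun hA => ?_⟩⟩
  · exact A.rpow_le_worstCaseRegret (BilateralTrade.densityBoundedCorrelatedValues_subset T 224)
      (BilateralTrade.correlatedValues_subset T) hA hT
  · exact A.rpow_le_worstCaseRegret subset_rfl
      ((BilateralTrade.densityBoundedCorrelatedValues_subset T 224).trans
        (BilateralTrade.correlatedValues_subset T)) hA hT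
  · exact A.rpow_le_worstCaseRegret
      ((BilateralTrade.densityBoundedCorrelatedValues_subset T 224).trans
        (BilateralTrade.correlatedValues_subset T)) subset_rfl hA hT
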